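/- **Encoding functions.** Let $\mathbb N^+=\{1,2,3,\dots\}$ and $\mathbb Z_N=\{0,1,\dots,N-1\}$ (integers modulo $N$). An *encoding function into $n$ bitstrings* is a bijection $\sigma\colon\{0,1,\dots,2^n-1\}\to\{0,1\}^n$. A *family of encoding functions* is a sequence $\{\sigma_n\}_{n\in\mathbb N^+}$ in which $\sigma_n$ is an encoding function into $n$ bitstrings; it is *computable* if some algorithm, on every input $(n,x)$ with $0\le x<2^n$, halts and outputs $\sigma_n(x)$. **Generic algorithms.** A *generic algorithm* is a probabilistic oracle Turing machine $\mathcal A$ (one fair coin flip per step, oracle calls in unit time). For an encoding function $\sigma$ into $n$ bitstrings and $1\le N\le 2^n$, its input is a list $\sigma(x_1),\dots,\sigma(x_k)$ with $x_1,\dots,x_k\in\mathbb Z_N$, together with the binary representations of $N$ and of the prime factors of $N$ with multiplicity. It may call the oracles $\mathrm{add}(\sigma(x),\sigma(y))=\sigma(x+y \bmod N)$ and $\mathrm{inv}(\sigma(x))=\sigma(-x\bmod N)$ for $x,y\in\mathbb Z_N$; an oracle query that is not about elements of $\sigma(\mathbb Z_N)$ is answered by the empty string. Its output $\mathcal A(N;\sigma(x_1),\dots,\sigma(x_k))$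 is a finite binary string, and a string $s$ is identified with the natural number whose binary representation is $1s$, minus $1$. The algorithm is *polynomial-time* if there is a polynomial $P$ such that, on all such inputs and for all coin flips, it halts within $P(L)$ steps, where $L$ is the length of the input. Let $\mathcal M_1,\mathcal M_2,\dots$ be the standard effective enumeration of all probabilistic oracle Turing machines (each machine occurring infinitely often), and for $i\in\mathbb N^+$ let $\mathcal A_i$ be the polynomial-time generic algorithm that executes $\mathcal M_i$ for at most $L^i+i$ steps, where $L$ is the length of the input, and then outputs the string that is at that time in the output position. **The experiment.** For a polynomial-time generic algorithm $\mathcal A$ and an encoding function $\sigma$ into $n$ bitstrings, let $\mathsf{DLog}_{\mathcal A}(n,\sigma)$ be the following experiment: choose an $n$-bit prime $p$ uniformly, choose $x\in\mathbb Z_p$ uniformly, run $\mathcal A$ with independent uniform coin flips; the outcome is $1$ if $\mathcal A(p;\sigma(1),\sigma(x))=x$, and $0$ otherwise. (For $n=1$ there is no $n$-bit prime, and the probability of the outcome $1$ is taken to be $0$.) **Theorem 8.4 (Main result III), with Corollary 8.5.** There exists a computable family $\{\sigma_n\}_{n\in\mathbb N^+}$ of encoding functions such that 1. the discrete logarithm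 problem is *effectively hard* relative to $\{\sigma_n\}$: there is a computable function $f\colon\mathbb N^+\times\mathbb N^+\to\mathbb N^+$ such that, for all $i,d,n\in\mathbb N^+$, if $n\ge f(i,d)$ then $$\Pr[\mathsf{DLog}_{\mathcal A_i}(n,\sigma_n)=1]\le\frac1{n^d};$$ 2. consequently the discrete logarithm problem is *hard* relative to $\{\sigma_n\}$: for every polynomial-time generic algorithm $\mathcal A$ and every $d\in\mathbb N^+$ there is $n_0\in\mathbb N^+$ such that, for all $n\ge n_0$, $$\Pr[\mathsf{DLog}_{\mathcal A}(n,\sigma_n)=1]\le\frac1{n^d}.$$ -/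

import Mathlib

namespace GGM

/-! ### Bit strings and encoding functions -/

/-- Finite binary strings, most significant bit first. -/
abbrev Str := List Bool

/-- The length-lexicographic identification of binary strings with natural numbers:
`s` is identified with the number whose binary representation is `1s`, minus one. -/
def strToNat (s : Str) : ℕ := s.foldl (fun a b => 2 * a + b.toNat) 1 - 1

/-- The binary representation of a natural number, most significant bit first. -/
def bin (N : ℕ) : Str := (Nat.bits N).reverse

/-- Encoding functions into `n` bitstrings: bijections from `{0, …, 2 ^ n - 1}` to `{0,1}ⁿ`. -/
abbrev Encf (n : ℕ) := Fin (2 ^ n) ≃ List.Vector Bool n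

/-- Families of encoding functions. (The component at `n = 0` carries no information: `Encf 0` has
exactly one element.) -/
abbrev Family := (n : ℕ) → Encf n

/-- The string `σ(k)`; only used for `k < 2 ^ n`. -/
def Encf.str {n : ℕ} (σ : Encf n) (k : ℕ) : Str :=
  if h : k < 2 ^ n then (σ ⟨k, h⟩).toList else []

/-- A family is computable if some algorithm maps `(n, x)` with `x < 2 ^ n` to `σ_n(x)`. -/
def Family.IsComputable (σ : Family) : Prop :=
  ∃ g : ℕ → ℕ → Str, Computable₂ g ∧ ∀ (n : ℕ) (x : Fin (2 ^ n)), g n x = (σ n x).toList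

/-! ### The group oracles -/

/-- The number `a ∈ ℤ_N = {0, …, N - 1}` with `σ(a) = s`, if there is one. -/
def Encf.log {n : ℕ} (σ : Encf n) (N : ℕ) (s : Str) : Option ℕ :=
  (List.range N).find? fun a => σ.str a == s

/-- `add(σ(a), σ(b)) = σ(a + b mod N)` on `σ(ℤ_N) × σ(ℤ_N)`; `none` on all other queries. -/
def Encf.add {n : ℕ} (σ : Encf n) (N : ℕ) (s t : Str) : Option Str :=
  match σ.log N s, σ.log N t with
  | some a, some b => some (σ.str ((a + b) % N))
  | _, _ => none

/-- `inv(σ(a)) = σ(-a mod N)` on `σ(ℤ_N)`; `none` on all other queries. -/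
def Encf.inv {n : ℕ} (σ : Encf n) (N : ℕ) (s : Str) : Option Str :=
  (σ.log N s).map fun a => σ.str ((N - a) % N)

/-! ### Probabilistic oracle Turing machines

A machine has a work tape (holding the input at the start and the output at the end) and an oracle
tape. Both are infinite in both directions. Tape symbols are natural numbers: `0` is the blank, `1`
and `2` are the bits 0 and 1, `3` is a separator, and all larger numbers are further symbols. States
are natural numbers too: `0` is the initial state and `1` the halting state. A machine is given by a
finite table, so that it has finitely many states and tape symbols. In each step it
receives one fair coin flip, on which its action may depend. -/

/-- A tape: the cells to the left of the head (nearest first), and the cells from the head on to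
the right. All cells outside of the two lists are blank. -/
abbrev Tape := List ℕ × List ℕ

/-- The symbol under the head. -/
def Tape.read (t : Tape) : ℕ := t.2.headD 0

/-- Overwrite the symbol under the head. -/
def Tape.write (t : Tape) (a : ℕ) : Tape := (t.1, a :: t.2.tail)

/-- Move the head: `none` is no move, `some false` is left, `some true` is right. -/
def Tape.move (t : Tape) : Option Bool → Tape
  | none => t
  | some false => (t.1.tail, t.1.headD 0 :: t.2)
  | some true => (t.2.headD 0 :: t.1, t.2.tail)

/-- The tape symbol of a bit. -/
def bitSym (b : Bool) : ℕ := if b then 2 else 1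

/-- The tape cells of a string. -/
def cells (s : Str) : List ℕ := s.map bitSym

/-- The string in the cells from the given ones on, up to the first symbol that is not a bit. -/
def readStr (l : List ℕ) : Str := (l.takeWhile fun a => a == 1 || a == 2).map fun a => a == 2

/-- A line of a transition table. The first component is the situation in which it applies:
(state, symbol read on the work tape, symbol read on the oracle tape, coin flip).
The second one is the action: (new state, symbol written on the work tape, symbol written on the
oracle tape, move on the work tape, move on the oracle tape, oracle call). The oracle call is made
after the moves; `none` is no call, `some false` is a call of `add`, `some true` a call of `inv`. -/
abbrev Rule := (ℕ × ℕ × ℕ × Bool) × (ℕ × ℕ × ℕ × Option Bool × Option Bool × Option Bool)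

/-- A probabilistic oracle Turing machine. If several lines apply, the first one counts; if none
applies, then the machine halts. -/
abbrev Machine := List Rule

/-- A configuration: state, work tape, oracle tape. -/
abbrev Config := ℕ × Tape × Tape

/-- The action of a machine in a given situation. -/
def Machine.action (M : Machine) (k : ℕ × ℕ × ℕ × Bool) :
    Option (ℕ × ℕ × ℕ × Option Bool × Option Bool × Option Bool) :=
  (M.find? fun r => r.1 == k).map Prod.snd

/-- The effect of an oracle call on the oracle tape. The arguments of the call are the string that
starts under the head and, for `add`, the string that follows after one separating cell. The tape
is erased and the answer is written on it, with the head on its first cell; the tape is left blank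
if the call is not one about elements of the group. -/
def oracleCall {n : ℕ} (σ : Encf n) (N : ℕ) (t : Tape) : Option Bool → Tape
  | none => t
  | some false =>
      let s₁ := readStr t.2
      let s₂ := readStr (t.2.drop (s₁.length + 1))
      ([], cells ((σ.add N s₁ s₂).getD []))
  | some true => ([], cells ((σ.inv N (readStr t.2)).getD []))

/-- One step of a machine, with coin flip `b`. Oracle calls take unit time. -/
def Machine.step {n : ℕ} (M : Machine) (σ : Encf n) (N : ℕ) (c : Config) (b : Bool) : Config :=
  if c.1 = 1 then c
  else
    match M.action (c.1, c.2.1.read, c.2.2.read, b) with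
    | none => (1, c.2.1, c.2.2)
    | some (q, a, e, u, v, call) =>
        (q, (c.2.1.write a).move u, oracleCall σ N ((c.2.2.write e).move v) call)

/-- The input of a generic algorithm: the binary representations of `N` and of its prime factors
(with multiplicity), and a list of encoded group elements. -/
def inputCells (N : ℕ) (l : List Str) : List ℕ :=
  cells (bin N) ++ [3] ++ N.primeFactorsList.flatMap (fun q => cells (bin q) ++ [3]) ++ [3] ++
    l.flatMap fun s => cells s ++ [3]

/-- The configuration after the run of `M` on input `(N; l)` with the given coin flips, one for each
step. -/
def Machine.run {n : ℕ} (M : Machine) (σ : Encf n) (N : ℕ) (l : List Str) (coins : List Bool) :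
    Config :=
  coins.foldl (M.step σ N) (0, ([], inputCells N l), ([], []))

/-- The output string after that run: it starts under the head of the work tape and ends before the
first symbol that is not a bit. -/
def Machine.output {n : ℕ} (M : Machine) (σ : Encf n) (N : ℕ) (l : List Str) (coins : List Bool) :
    Str :=
  readStr (M.run σ N l coins).2.1.2

/-! ### The discrete logarithm experiment -/

/-- The `n`-bit primes. (There are some for every `n ≥ 2`.) -/
def bitPrimes (n : ℕ) : Finset ℕ := (Finset.Ico (2 ^ (n - 1)) (2 ^ n)).filter Nat.Prime

/-- The fraction of coin flips with which `M`, run for `T` steps on `(p; σ(1), σ(x))`, outputs `x`. -/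
def coinProb {n : ℕ} (M : Machine) (T : ℕ) (σ : Encf n) (p x : ℕ) : ℚ :=
  (((Finset.univ : Finset (Fin T → Bool)).filter fun r =>
    strToNat (M.output σ p [σ.str 1, σ.str x] (List.ofFn r)) = x).card : ℚ) / 2 ^ T

/-- The probability that the discrete logarithm experiment for `n` and `σ` has outcome `1`, where the
algorithm is the machine `M`, run for at most `T L` steps on inputs of length `L`: choose an `n`-bit
prime `p`, then an `x ∈ ℤ_p`, then the coin flips, all uniformly. -/
def dlogProb (M : Machine) (T : ℕ → ℕ) {n : ℕ} (σ : Encf n) : ℚ :=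
  (∑ p ∈ bitPrimes n,
    (∑ x ∈ Finset.range p,
      coinProb M (T (inputCells p [σ.str 1, σ.str x]).length) σ p x) / p) / (bitPrimes n).card

/-! ### Hardness -/

/-- An effective enumeration of all machines, in which every machine occurs infinitely often. -/
def machine (k : ℕ) : Machine := ((Encodable.decode (Nat.unpair k).1 : Option Machine)).getD []

/-- The probability of success of the `k`th polynomial-time generic algorithm, which is the `k`th
machine, run for at most `L ^ k + k` steps on inputs of length `L`. -/
def dlogProbEnum (k : ℕ) {n : ℕ} (σ : Encf n) : ℚ := dlogProb (machine k) (fun L => L ^ k + k) σ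

/-- The discrete logarithm problem is effectively hard relative to `σ`. -/
def EffectivelyHard (σ : Family) : Prop :=
  ∃ f : ℕ → ℕ → ℕ, Computable₂ f ∧
    ∀ i d n : ℕ, 1 ≤ i → 1 ≤ d → 1 ≤ n → f i d ≤ n → dlogProbEnum i (σ n) ≤ 1 / (n : ℚ) ^ d

/-- `M` halts within `T L` steps on all inputs of length `L` of a generic algorithm, for all encoding
functions and all coin flips. -/
def Machine.HaltsWithin (M : Machine) (T : ℕ → ℕ) : Prop :=
  ∀ (n : ℕ) (σ : Encf n) (N : ℕ) (xs : List ℕ), 1 ≤ n → 1 ≤ N → N ≤ 2 ^ n → (∀ x ∈ xs, x < N) →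
    ∀ coins : List Bool, coins.length = T (inputCells N (xs.map σ.str)).length →
      (M.run σ N (xs.map σ.str) coins).1 = 1

/-- The discrete logarithm problem is hard relative to `σ`: every machine whose running time is
bounded by a polynomial `P` has negligible probability of success. -/
def Hard (σ : Family) : Prop :=
  ∀ (M : Machine) (P : Polynomial ℕ), M.HaltsWithin (fun L => P.eval L) →
    ∀ d : ℕ, 1 ≤ d → ∃ n₀ : ℕ, 1 ≤ n₀ ∧ ∀ n : ℕ, n₀ ≤ n →
      dlogProb M (fun L => P.eval L) (σ n) ≤ 1 / (n : ℚ) ^ d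

end GGM

/-!
The family is found by exhaustive search. For each `n`, the search runs through the tables of the
encoding functions into `n` bitstrings until one is found against which each of the first `level n`
machines, run for `steps n i` steps, solves the discrete logarithm problem with probability at most
`1 / n ^ level n`, where `level n` is about `log₂ n`. Since `level` is computable and tends to
infinity, the discrete logarithm problem is effectively hard; it is then hard because every
polynomial-time machine occurs in the enumeration with a bound on its running time that never takes
effect (`EffectivelyHard.hard`).

That the search succeeds is shown by counting. For fixed coin flips, and a random encoding function
and a random secret `x`, Shoup's argument for generic groups applies (`card_success_le`): whatever
the machine knows after some oracle calls is a list of strings together with forms `a * x + b` (or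
numbers outside of `ℤ_p`) that they encode. A new sum or inverse has a new form, and the answer
carries information about `x` only if two different forms coincide at `x`, which happens for at most
one `x` for each pair of forms (`Bound.reveal`). A string that the machine makes up may well be the
encoding of a group element; it then encodes a number that does not depend on `x`, which may be
revealed without loss (`Bound.guess`). As long as there is no coincidence, all secrets at which the
known forms have distinct values are equally likely, because a permutation of the numbers transports
the encoding functions that agree with the knowledge (`cnt_secret_le`). Hence `T` steps succeed with
probability `O(T ^ 2 / 2 ^ n)`, and for large `n` these bounds are so small that the first `level n`
machines together rule out only a part of all encoding functions (`exists_good_encf`).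

The search is computable because the condition on a table is primitive recursive
(`primrecRel_goodTable`): machines can be simulated with an encoding function that is given as a
list of strings, and the probabilities are compared as numbers of successes.
-/

namespace GGM

/-! ### Knowledge about the secret in the generic group model -/

/-- What the machine can know about a group element in terms of the secret `x ∈ ℤ_p`: it is
`a * x + b` for known `a, b`, or it is the known number `p + v` outside of `ℤ_p`. -/
inductive Form (p : ℕ)
  | lin (a b : ZMod p)
  | out (v : ℕ)

/-- The number that a form denotes when the secret is `x`. -/
def Form.eval {p : ℕ} : Form p → ZMod p → ℕ
  | .lin a b, x => (a * x + b).val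
  | .out v, _ => p + v

/-- Two different forms have the same value for at most one secret. -/
theorem Form.eq_of_eval_eq {p : ℕ} [Fact p.Prime] {F G : Form p} (h : F ≠ G) {x y : ZMod p}
    (hx : F.eval x = G.eval x) (hy : F.eval y = G.eval y) : x = y := by
  cases F with
  | lin a b =>
    cases G with
    | lin a' b' =>
      simp only [Form.eval] at hx hy
      have hx := ZMod.val_injective p hx
      have hy := ZMod.val_injective p hy
      have h3 : (a - a') * (x - y) = 0 := by linear_combination hx - hy
      rcases mul_eq_zero.1 h3 with h4 | h4
      · exfalso
        apply h
        have h5 : a = a' := sub_eq_zero.1 h4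
        subst h5
        have h6 : b = b' := by linear_combination hx
        rw [h6]
      · exact sub_eq_zero.1 h4
    | out v =>
      simp only [Form.eval] at hx
      have := ZMod.val_lt (a * x + b)
      omega
  | out v =>
    cases G with
    | lin a' b' =>
      simp only [Form.eval] at hx
      have := ZMod.val_lt (a' * x + b')
      omega
    | out v' =>
      simp only [Form.eval] at hx
      exact absurd (by rw [show v = v' by omega]) h

section Strings

variable {n : ℕ}

theorem Encf.str_of_lt (σ : Encf n) {k : ℕ} (h : k < 2 ^ n) : σ.str k = (σ ⟨k, h⟩).toList := by
  simp [Encf.str, h]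

theorem Encf.length_str (σ : Encf n) {k : ℕ} (h : k < 2 ^ n) : (σ.str k).length = n := by
  simp [Encf.str_of_lt σ h]

theorem Encf.lt_of_length_str (hn : 1 ≤ n) (σ : Encf n) {k : ℕ} (h : (σ.str k).length = n) :
    k < 2 ^ n := by
  by_contra h'
  simp [Encf.str, h'] at h
  omega

theorem Encf.str_inj (σ : Encf n) {j k : ℕ} (hj : j < 2 ^ n) (hk : k < 2 ^ n)
    (h : σ.str j = σ.str k) : j = k := by
  rw [σ.str_of_lt hj, σ.str_of_lt hk] at h
  have := σ.injective (List.Vector.toList_injective h)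
  simpa using this

theorem Encf.exists_str (σ : Encf n) {s : Str} (hs : s.length = n) :
    ∃ k, k < 2 ^ n ∧ σ.str k = s := by
  obtain ⟨v, rfl⟩ : ∃ v : List.Vector Bool n, v.toList = s := ⟨⟨s, hs⟩, rfl⟩
  exact ⟨σ.symm v, (σ.symm v).2, by rw [σ.str_of_lt (σ.symm v).2, Fin.eta, Equiv.apply_symm_apply]⟩

theorem Encf.log_eq_some (σ : Encf n) {N k : ℕ} (hN : N ≤ 2 ^ n) (hk : k < N) :
    σ.log N (σ.str k) = some k := by
  unfold Encf.log
  rw [List.find?_range_eq_some]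
  refine ⟨by simp, by simpa using hk, fun j hj => ?_⟩
  have h : σ.str j ≠ σ.str k := fun h => by
    have := σ.str_inj (by omega) (by omega) h
    omega
  simpa using h

theorem Encf.log_eq_none (σ : Encf n) {N : ℕ} {s : Str} (h : ∀ k < N, σ.str k ≠ s) :
    σ.log N s = none := by
  unfold Encf.log
  simpa [List.find?_eq_none] using h

end Strings

section Knowledge

variable {n p : ℕ}

/-- `K` is a possible state of knowledge: all strings are `n` bits long, and each string is
assigned to only one form. -/
def Valid (n : ℕ) {p : ℕ} (K : List (Form p × Str)) : Prop :=
  (∀ q ∈ K, q.2.length = n) ∧ ∀ q ∈ K, ∀ r ∈ K, q.2 = r.2 → q.1 = r.1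

/-- The encoding function and the secret agree with the knowledge `K`. -/
def Agrees (K : List (Form p × Str)) (u : Encf n × ZMod p) : Prop :=
  ∀ q ∈ K, u.1.str (q.1.eval u.2) = q.2

theorem agrees_cons {K : List (Form p × Str)} {F : Form p} {s : Str} {u : Encf n × ZMod p} :
    Agrees ((F, s) :: K) u ↔ u.1.str (F.eval u.2) = s ∧ Agrees K u := by
  simp [Agrees]

theorem Valid.cons {K : List (Form p × Str)} (hK : Valid n K) {F : Form p} {s : Str}
    (hs : s.length = n) (h : ∀ q ∈ K, q.2 ≠ s) : Valid n ((F, s) :: K) := by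
  refine ⟨?_, ?_⟩
  · simpa [hs] using hK.1
  · intro q hq r hr e
    rcases List.mem_cons.1 hq with rfl | hq <;> rcases List.mem_cons.1 hr with rfl | hr
    · rfl
    · exact absurd e.symm (h r hr)
    · exact absurd e (h q hq)
    · exact hK.2 q hq r hr e

theorem log_of_length_ne (hp : p ≤ 2 ^ n) {s : Str} (hs : s.length ≠ n) (σ : Encf n) :
    σ.log p s = none :=
  σ.log_eq_none fun k hk e => hs (by rw [← e, σ.length_str (hk.trans_le hp)])

variable [Fact p.Prime]

open Classical in
/-- The number of pairs of an encoding function and a secret that agree with `K` and satisfy `W`. -/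
noncomputable def cnt (K : List (Form p × Str)) (W : Encf n × ZMod p → Prop) : ℕ :=
  (Finset.univ.filter fun u : Encf n × ZMod p => Agrees K u ∧ W u).card

theorem cnt_mono {K K' : List (Form p × Str)} {W W' : Encf n × ZMod p → Prop}
    (h : ∀ u, Agrees K u → W u → Agrees K' u ∧ W' u) : cnt K W ≤ cnt K' W' := by
  classical
  unfold cnt
  refine Finset.card_le_card fun u hu => ?_
  simp only [Finset.mem_filter, Finset.mem_univ, true_and] at hu ⊢
  exact h u hu.1 hu.2

theorem cnt_congr {K : List (Form p × Str)} {W W' : Encf n × ZMod p → Prop}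
    (h : ∀ u, Agrees K u → (W u ↔ W' u)) : cnt K W = cnt K W' :=
  le_antisymm (cnt_mono fun u hu hW => ⟨hu, (h u hu).1 hW⟩)
    (cnt_mono fun u hu hW => ⟨hu, (h u hu).2 hW⟩)

/-- The count splits according to the value of `f`. -/
theorem cnt_eq_sum {ι : Type*} [DecidableEq ι] (K : List (Form p × Str))
    (W : Encf n × ZMod p → Prop) (f : Encf n × ZMod p → ι) (s : Finset ι)
    (hs : ∀ u, Agrees K u → f u ∈ s) :
    cnt K W = ∑ i ∈ s, cnt K fun u => W u ∧ f u = i := by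
  classical
  unfold cnt
  rw [Finset.card_eq_sum_card_fiberwise (f := f) (t := s)]
  · refine Finset.sum_congr rfl fun i _ => ?_
    rw [Finset.filter_filter]
    congr 1
    ext u
    simp [and_assoc]
  · intro u hu
    simp only [Finset.coe_filter, Finset.mem_univ, true_and, Set.mem_ofPred_eq] at hu
    exact hs u hu.1

theorem exists_of_cnt_ne_zero {K : List (Form p × Str)} {W : Encf n × ZMod p → Prop}
    (h : cnt K W ≠ 0) : ∃ u, Agrees K u ∧ W u := by
  classical
  unfold cnt at h
  obtain ⟨u, hu⟩ := Finset.card_pos.1 (Nat.pos_of_ne_zero h)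
  exact ⟨u, by simpa using hu⟩

/-- A secret `y` at which the forms in `K` have distinct values is at least as likely as any other
secret `x`: a permutation of the numbers that takes the values at `y` to the values at `x`
transports the encoding functions that agree with `K` at `x` to such functions at `y`. -/
theorem cnt_secret_le (hn : 1 ≤ n) (hp : p ≤ 2 ^ n) {K : List (Form p × Str)} (hK : Valid n K)
    (x y : ZMod p)
    (hy : ∀ q ∈ K, ∀ r ∈ K, q.1.eval y = r.1.eval y → q.1 = r.1) :
    cnt (n := n) K (fun u => u.2 = x) ≤ cnt (n := n) K (fun u => u.2 = y) := by
  classical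
  by_cases h0 : cnt (n := n) K (fun u => u.2 = x) = 0
  · omega
  obtain ⟨⟨σ₀, x'⟩, h₀, rfl⟩ := exists_of_cnt_ne_zero h0
  dsimp only at *
  have hlt : ∀ q ∈ K, q.1.eval x' < 2 ^ n := fun q hq =>
    σ₀.lt_of_length_str hn (by rw [show σ₀.str (q.1.eval x') = q.2 from h₀ q hq, hK.1 q hq])
  have hlt' : ∀ q ∈ K, q.1.eval y < 2 ^ n := by
    intro q hq
    have := hlt q hq
    cases h : q.1 with
    | lin a b => exact (ZMod.val_lt _).trans_le hp
    | out v => rw [h] at this; exact this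
  let ι := {F : Form p // ∃ s, (F, s) ∈ K}
  let f : ι → Fin (2 ^ n) := fun F => ⟨F.1.eval y, by
    obtain ⟨s, hs⟩ := F.2
    exact hlt' _ hs⟩
  let g : ι → Fin (2 ^ n) := fun F => ⟨F.1.eval x', by
    obtain ⟨s, hs⟩ := F.2
    exact hlt _ hs⟩
  have hf : Function.Injective f := by
    rintro ⟨F, s, hs⟩ ⟨G, t, ht⟩ h
    have := hy _ hs _ ht (by simpa [f] using h)
    exact Subtype.ext this
  have hg : Function.Injective g := by
    rintro ⟨F, s, hs⟩ ⟨G, t, ht⟩ h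
    have h1 : F.eval x' = G.eval x' := by simpa [g] using h
    have h2 : σ₀.str (F.eval x') = s := h₀ _ hs
    have h3 : σ₀.str (G.eval x') = t := h₀ _ ht
    exact Subtype.ext (hK.2 _ hs _ ht (by rw [← h2, ← h3, h1]))
  have : Finite ι := Finite.of_injective f hf
  obtain ⟨π, hπ⟩ := Equiv.Perm.exists_extending_pair f g hf hg
  unfold cnt
  refine Finset.card_le_card_of_injOn (fun u => (π.trans u.1, y)) ?_ ?_
  · rintro ⟨σ, x⟩ hu
    simp only [Finset.coe_filter, Finset.mem_univ, true_and, Set.mem_ofPred_eq] at hu ⊢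
    obtain ⟨hu, rfl⟩ := hu
    refine ⟨fun q hq => ?_, trivial⟩
    rw [← hu q hq, Encf.str_of_lt _ (hlt' q hq), Encf.str_of_lt _ (hlt q hq), Equiv.trans_apply]
    congr 2
    exact hπ ⟨q.1, q.2, hq⟩
  · rintro ⟨σ, x⟩ hu ⟨σ', x'⟩ hu' h
    simp only [Finset.coe_filter, Finset.mem_univ, true_and, Set.mem_ofPred_eq] at hu hu'
    obtain ⟨-, rfl⟩ := hu
    obtain ⟨-, rfl⟩ := hu'
    simp only [Prod.mk.injEq, and_true] at h
    refine Prod.ext ?_ rfl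
    exact Equiv.ext fun z => by simpa using congrArg (fun e => e (π.symm z)) h

/-- Given the knowledge `K` about `m` forms, no secret has conditional probability above
`1 / (p - m ^ 2)`: two distinct forms have the same value at no more than one secret, so at all but
`m ^ 2` secrets the forms have distinct values, and each of these secrets is at least as likely as
`x`. -/
theorem mul_cnt_secret_le (hn : 1 ≤ n) (hp : p ≤ 2 ^ n) {K : List (Form p × Str)}
    (hK : Valid n K) (x : ZMod p) :
    (p - K.length ^ 2) * cnt (n := n) K (fun u => u.2 = x) ≤ cnt (n := n) K fun _ => True := by
  classical
  let B : Finset (ZMod p) := (K.toFinset ×ˢ K.toFinset).biUnion fun qr =>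
    Finset.univ.filter fun y => qr.1.1.eval y = qr.2.1.eval y ∧ qr.1.1 ≠ qr.2.1
  have hB : B.card ≤ K.length ^ 2 := by
    refine (Finset.card_biUnion_le_card_mul _ _ 1 ?_).trans ?_
    · rintro ⟨q, r⟩ -
      rw [Finset.card_le_one]
      intro y hy z hz
      simp only [Finset.mem_filter, Finset.mem_univ, true_and] at hy hz
      exact Form.eq_of_eval_eq hy.2 hy.1 hz.1
    · rw [mul_one, Finset.card_product, sq]
      exact Nat.mul_le_mul (List.toFinset_card_le K) (List.toFinset_card_le K)
  have hG : p - K.length ^ 2 ≤ Bᶜ.card := by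
    rw [Finset.card_compl, ZMod.card]
    omega
  rw [cnt_eq_sum K (fun _ => True) (fun u => u.2) Finset.univ (by simp)]
  simp only [true_and]
  calc _ ≤ Bᶜ.card * cnt (n := n) K (fun u => u.2 = x) := Nat.mul_le_mul_right _ hG
    _ = ∑ y ∈ Bᶜ, cnt (n := n) K (fun u => u.2 = x) := by simp
    _ ≤ ∑ y ∈ Bᶜ, cnt (n := n) K (fun u => u.2 = y) := by
        refine Finset.sum_le_sum fun y hy => cnt_secret_le hn hp hK x y fun q hq r hr h => ?_
        by_contra hne
        apply Finset.mem_compl.1 hy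
        simp only [B, Finset.mem_biUnion, Finset.mem_product, List.mem_toFinset]
        exact ⟨(q, r), ⟨hq, hr⟩, by simp [h, hne]⟩
    _ ≤ _ := Finset.sum_le_sum_of_subset (Finset.subset_univ _)

/-- Given the knowledge `K`, the event `W` has conditional probability at most `β / D`, stated
without division. If nothing agrees with `K`, or if `D = 0`, this is trivially true. -/
def Bound (D : ℕ) (K : List (Form p × Str)) (W : Encf n × ZMod p → Prop) (β : ℕ) : Prop :=
  D * cnt K W ≤ β * cnt (n := n) K fun _ => True

theorem Bound.congr {D β : ℕ} {K : List (Form p × Str)} {W W' : Encf n × ZMod p → Prop}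
    (h : Bound D K W β) (hW : ∀ u, Agrees K u → (W' u ↔ W u)) : Bound D K W' β := by
  unfold Bound
  rwa [cnt_congr hW]

theorem Bound.mono {D β β' : ℕ} {K : List (Form p × Str)} {W : Encf n × ZMod p → Prop}
    (h : Bound D K W β) (hβ : β ≤ β') : Bound D K W β' :=
  le_trans h (Nat.mul_le_mul_right _ hβ)

/-- Asking for the string of a form costs `m / D`. Unless the value of the form happens to be that
of a form known before, the answer is a new string, and each answer is treated separately. A
coincidence with one of the at most `m` known forms determines the secret, and so has conditional
probability at most `1 / D`. -/
theorem Bound.reveal (hn : 1 ≤ n) (hp : p ≤ 2 ^ n) {m D β : ℕ} (hD : D ≤ p - m ^ 2)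
    {K : List (Form p × Str)} (hK : Valid n K) (hm : K.length ≤ m) {W : Encf n × ZMod p → Prop}
    (a b : ZMod p)
    (h : ∀ K', Valid n K' → K'.length ≤ K.length + 1 → K ⊆ K' → ∀ t, (Form.lin a b, t) ∈ K' →
      Bound D K' W β) :
    Bound D K W (β + m) := by
  classical
  set F := Form.lin a b with hF
  by_cases hmem : ∃ t, (F, t) ∈ K
  · obtain ⟨t, ht⟩ := hmem
    exact (h K hK (by omega) (List.Subset.refl _) t ht).mono (by omega)
  have hlt : ∀ u : Encf n × ZMod p, F.eval u.2 < 2 ^ n := fun u => (ZMod.val_lt _).trans_le hp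
  let f : Encf n × ZMod p → Str := fun u => u.1.str (F.eval u.2)
  let S : Finset Str := (K.map Prod.snd).toFinset
  let T : Finset Str := Finset.univ.image f
  have hf : ∀ u, Agrees K u → f u ∈ T ∪ S := fun u _ => by simp [T]
  have hcons : ∀ W' : Encf n × ZMod p → Prop, ∀ t,
      cnt K (fun u => W' u ∧ f u = t) = cnt ((F, t) :: K) W' := by
    intro W' t
    apply le_antisymm <;> refine cnt_mono fun u hu hW => ?_
    · exact ⟨agrees_cons.2 ⟨hW.2, hu⟩, hW.1⟩
    · exact ⟨(agrees_cons.1 hu).2, hW, (agrees_cons.1 hu).1⟩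
  unfold Bound
  have hS : S.card ≤ m := (List.toFinset_card_le _).trans (by simpa using hm)
  rw [cnt_eq_sum K W f _ hf, ← Finset.sum_sdiff (Finset.subset_union_right (s₁ := T) (s₂ := S)),
    mul_add, add_mul]
  refine Nat.add_le_add ?_ ?_
  -- The answer is a new string.
  · rw [cnt_eq_sum K (fun _ => True) f _ hf, Finset.mul_sum, Finset.mul_sum]
    refine le_trans ?_ (Finset.sum_le_sum_of_subset (Finset.sdiff_subset (t := S)))
    refine Finset.sum_le_sum fun t ht => ?_
    rw [hcons, hcons]
    simp only [Finset.mem_sdiff, Finset.mem_union] at ht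
    obtain ⟨ht1, ht2⟩ := ht
    have ht1 := ht1.resolve_right ht2
    simp only [T, Finset.mem_image, Finset.mem_univ, true_and] at ht1
    obtain ⟨u, rfl⟩ := ht1
    refine h _ (hK.cons (u.1.length_str (hlt u)) fun q hq e => ht2 ?_) (by simp)
      (List.subset_cons_self _ _) (f u) (by simp)
    simp only [S, List.mem_toFinset, List.mem_map]
    exact ⟨q, hq, e⟩
  -- The answer is the string of a known form.
  · rw [Finset.mul_sum]
    refine (Finset.sum_le_card_nsmul _ _ (cnt (n := n) K fun _ => True) fun t ht => ?_).trans
      (by rw [smul_eq_mul]; exact Nat.mul_le_mul_right _ hS)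
    simp only [S, List.mem_toFinset, List.mem_map] at ht
    obtain ⟨q, hq, rfl⟩ := ht
    have hne : F ≠ q.1 := fun e => hmem ⟨q.2, by rw [e]; exact hq⟩
    by_cases h0 : cnt K (fun u => W u ∧ f u = q.2) = 0
    · simp [h0]
    obtain ⟨u₀, hu₀, -, e₀⟩ := exists_of_cnt_ne_zero h0
    have key : ∀ u : Encf n × ZMod p, Agrees K u → f u = q.2 → F.eval u.2 = q.1.eval u.2 := by
      intro u hu e
      have h1 := hu q hq
      exact u.1.str_inj (hlt u) (u.1.lt_of_length_str hn (by rw [h1, hK.1 q hq]))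
        (by rw [h1]; exact e)
    calc D * cnt K (fun u => W u ∧ f u = q.2)
        ≤ (p - K.length ^ 2) * cnt (n := n) K (fun u => u.2 = u₀.2) := by
          refine Nat.mul_le_mul (hD.trans ?_) (cnt_mono fun u hu hW => ⟨hu, ?_⟩)
          · have := Nat.pow_le_pow_left hm 2
            omega
          · exact Form.eq_of_eval_eq hne (key u hu hW.2) (key u₀ hu₀ e₀)
      _ ≤ _ := mul_cnt_secret_le hn hp hK _

/-- The form of a number below `2 ^ n`. -/
def constForm (p k : ℕ) : Form p := if k < p then .lin 0 k else .out (k - p)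

theorem constForm_eval {k : ℕ} (x : ZMod p) : (constForm p k).eval x = k := by
  unfold constForm
  split_ifs with h
  · simp [Form.eval, ZMod.val_natCast_of_lt h]
  · simp only [Form.eval]
    omega

/-- The form of the string `s` is known, or `s` is no string of a group element at all. -/
def Known (n : ℕ) (K : List (Form p × Str)) (s : Str) : Prop :=
  (∃ F, (F, s) ∈ K) ∨ s.length ≠ n

/-- Guessing a string that is not known costs nothing: the bound holds if it holds for every number
that the string may denote, and that number is then known as a constant form, which does not
involve the secret. -/
theorem Bound.guess {D β : ℕ} {K : List (Form p × Str)} (hK : Valid n K)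
    {W : Encf n × ZMod p → Prop} (s : Str)
    (h : ∀ K', Valid n K' → K'.length ≤ K.length + 1 → K ⊆ K' → Known n K' s → Bound D K' W β) :
    Bound D K W β := by
  classical
  by_cases hs : Known n K s
  · exact h K hK (by omega) (List.Subset.refl _) hs
  simp only [Known, not_or, not_exists, not_not] at hs
  obtain ⟨hs, hsn⟩ := hs
  have hex : ∀ u : Encf n × ZMod p, ∃ k, k < 2 ^ n ∧ u.1.str k = s := fun u => u.1.exists_str hsn
  choose f hflt hstr using hex
  have hf : ∀ u, Agrees K u → f u ∈ Finset.range (2 ^ n) := fun u _ => Finset.mem_range.2 (hflt u)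
  have hcons : ∀ W' : Encf n × ZMod p → Prop, ∀ k ∈ Finset.range (2 ^ n),
      cnt K (fun u => W' u ∧ f u = k) = cnt ((constForm p k, s) :: K) W' := by
    intro W' k hk
    apply le_antisymm <;> refine cnt_mono fun u hu hW => ?_
    · refine ⟨agrees_cons.2 ⟨?_, hu⟩, hW.1⟩
      rw [constForm_eval, ← hW.2, hstr]
    · have h1 := (agrees_cons.1 hu).1
      rw [constForm_eval] at h1
      exact ⟨(agrees_cons.1 hu).2, hW, u.1.str_inj (hflt u) (Finset.mem_range.1 hk)
        ((hstr u).trans h1.symm)⟩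
  unfold Bound
  rw [cnt_eq_sum K W f _ hf, cnt_eq_sum K (fun _ => True) f _ hf, Finset.mul_sum, Finset.mul_sum]
  refine Finset.sum_le_sum fun k hk => ?_
  rw [hcons _ k hk, hcons _ k hk]
  exact h _ (hK.cons hsn fun q hq e => hs q.1 (e ▸ hq)) (by simp) (List.subset_cons_self _ _)
    (Or.inl ⟨_, List.mem_cons_self⟩)

/-- The element of `ℤ_p` denoted by a form, if any. -/
def Form.log {p : ℕ} : Form p → ZMod p → Option ℕ
  | .lin a b, x => some (a * x + b).val
  | .out _, _ => none

theorem log_of_agrees (hn : 1 ≤ n) (hp : p ≤ 2 ^ n) {K : List (Form p × Str)} (hK : Valid n K)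
    {F : Form p} {s : Str} (h : (F, s) ∈ K) {u : Encf n × ZMod p} (hu : Agrees K u) :
    u.1.log p s = F.log u.2 := by
  have h1 : u.1.str (F.eval u.2) = s := hu _ h
  have h2 : F.eval u.2 < 2 ^ n := u.1.lt_of_length_str hn (by rw [h1]; exact hK.1 _ h)
  cases F with
  | lin a b =>
    rw [← h1]
    exact u.1.log_eq_some hp (ZMod.val_lt _)
  | out v =>
    refine u.1.log_eq_none fun k hk e => ?_
    have := u.1.str_inj (hk.trans_le hp) h2 (e.trans h1.symm)
    simp only [Form.eval] at this
    omega

/-- An operation whose result is determined by the knowledge: it is either not defined, or it is the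
string of a form. -/
theorem Bound.answer (hn : 1 ≤ n) (hp : p ≤ 2 ^ n) {m D β : ℕ} (hD : D ≤ p - m ^ 2)
    {K : List (Form p × Str)} (hK : Valid n K) (hm : K.length ≤ m)
    {W : Option Str → Encf n × ZMod p → Prop} (g : Encf n × ZMod p → Option Str)
    (hg : (∀ u, Agrees K u → g u = none) ∨
      ∃ a b : ZMod p, ∀ u, Agrees K u → g u = some (u.1.str (a * u.2 + b).val))
    (h : ∀ K', Valid n K' → K'.length ≤ K.length + 1 → ∀ t, Bound D K' (W t) β) :
    Bound D K (fun u => W (g u) u) (β + m) := by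
  rcases hg with hg | ⟨a, b, hg⟩
  · exact ((h K hK (by omega) none).congr fun u hu => by rw [hg u hu]).mono (by omega)
  · refine Bound.reveal hn hp hD hK hm a b fun K' hK' hl hsub t ht => ?_
    refine (h K' hK' hl (some t)).congr fun u hu => ?_
    have h1 : u.1.str (a * u.2 + b).val = t := hu _ ht
    rw [hg u fun q hq => hu q (hsub hq), h1]

/-- An oracle call extends the knowledge by at most three strings. -/
theorem Bound.oracleCall (hn : 1 ≤ n) (hp : p ≤ 2 ^ n) {m D β : ℕ} (hD : D ≤ p - m ^ 2)
    {K : List (Form p × Str)} (hK : Valid n K) (hm : K.length + 3 ≤ m)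
    {W : Tape → Encf n × ZMod p → Prop} (t : Tape) (call : Option Bool)
    (h : ∀ K', Valid n K' → K'.length ≤ K.length + 3 → ∀ t, Bound D K' (W t) β) :
    Bound D K (fun u => W (oracleCall u.1 p t call) u) (β + m) := by
  rcases call with _ | _ | _
  · exact (h K hK (by omega) t).mono (by omega)
  · simp only [GGM.oracleCall]
    set s₁ := readStr t.2
    set s₂ := readStr (t.2.drop (s₁.length + 1))
    refine Bound.guess hK s₁ fun K₁ hK₁ hl₁ hs₁ k₁ => Bound.guess hK₁ s₂ fun K₂ hK₂ hl₂ hs₂ k₂ => ?_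
    refine Bound.answer hn hp hD hK₂ (by omega) (fun u => u.1.add p s₁ s₂)
      (W := fun r u => W ([], cells (r.getD [])) u) ?_ fun K' hK' hl r => h K' hK' (by omega) _
    rcases k₁ with ⟨F₁, k₁⟩ | k₁
    swap
    · exact Or.inl fun u _ => by simp [Encf.add, log_of_length_ne hp k₁]
    rcases k₂ with ⟨F₂, k₂⟩ | k₂
    swap
    · exact Or.inl fun u _ => by simp [Encf.add, log_of_length_ne hp k₂]
    have k₁ := hs₂ k₁
    rcases F₁ with ⟨a₁, b₁⟩ | v
    swap
    · exact Or.inl fun u hu => by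
        rw [Encf.add, log_of_agrees hn hp hK₂ k₁ hu]
        rfl
    rcases F₂ with ⟨a₂, b₂⟩ | v
    swap
    · exact Or.inl fun u hu => by
        rw [Encf.add, log_of_agrees hn hp hK₂ k₁ hu, log_of_agrees hn hp hK₂ k₂ hu]
        rfl
    refine Or.inr ⟨a₁ + a₂, b₁ + b₂, fun u hu => ?_⟩
    rw [Encf.add, log_of_agrees hn hp hK₂ k₁ hu, log_of_agrees hn hp hK₂ k₂ hu]
    simp only [Form.log]
    rw [← ZMod.val_add]
    congr 3
    ring
  · simp only [GGM.oracleCall]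
    set s := readStr t.2
    refine Bound.guess hK s fun K₁ hK₁ hl₁ hs₁ k₁ => ?_
    refine Bound.answer hn hp hD hK₁ (by omega) (fun u => u.1.inv p s)
      (W := fun r u => W ([], cells (r.getD [])) u) ?_ fun K' hK' hl r => h K' hK' (by omega) _
    rcases k₁ with ⟨F, k₁⟩ | k₁
    swap
    · exact Or.inl fun u _ => by simp [Encf.inv, log_of_length_ne hp k₁]
    rcases F with ⟨a, b⟩ | v
    swap
    · exact Or.inl fun u hu => by
        rw [Encf.inv, log_of_agrees hn hp hK₁ k₁ hu]
        rfl
    refine Or.inr ⟨-a, -b, fun u hu => ?_⟩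
    rw [Encf.inv, log_of_agrees hn hp hK₁ k₁ hu]
    simp only [Form.log, Option.map_some]
    rw [← ZMod.neg_val']
    congr 3
    ring

/-- With fixed coin flips, a machine that starts with any knowledge and in any configuration outputs
the secret with probability at most `(1 + T * m) / D`: each of the `T` steps costs at most `m / D`,
and the final output, which the knowledge determines, is correct with probability at most
`1 / D`. -/
theorem bound_foldl_step (hn : 1 ≤ n) (hp : p ≤ 2 ^ n) (M : Machine) {m D : ℕ} (hD : D ≤ p - m ^ 2)
    (coins : List Bool) : ∀ (K : List (Form p × Str)) (c : Config), Valid n K →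
      K.length + 3 * coins.length ≤ m →
      Bound (n := n) D K (fun u =>
        strToNat (readStr (coins.foldl (M.step u.1 p) c).2.1.2) = u.2.val)
        (1 + coins.length * m) := by
  induction coins with
  | nil =>
    intro K c hK hm
    simp only [List.length_nil, zero_mul, add_zero, mul_zero, List.foldl_nil] at hm ⊢
    unfold Bound
    rw [one_mul]
    refine le_trans (Nat.mul_le_mul (hD.trans ?_) (cnt_mono fun u hu hW => ⟨hu, ?_⟩))
      (mul_cnt_secret_le hn hp hK ((strToNat (readStr c.2.1.2) : ℕ) : ZMod p))
    · have := Nat.pow_le_pow_left hm 2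
      omega
    · rw [hW, ZMod.natCast_zmod_val]
  | cons b coins ih =>
    intro K c hK hm
    simp only [List.length_cons, List.foldl_cons] at hm ⊢
    have hβ : 1 + (coins.length + 1) * m = 1 + coins.length * m + m := by ring
    rw [hβ]
    have stay : ∀ c', (∀ u : Encf n × ZMod p, M.step u.1 p c b = c') →
        Bound (n := n) D K (fun u =>
          strToNat (readStr (coins.foldl (M.step u.1 p) (M.step u.1 p c b)).2.1.2) = u.2.val)
          (1 + coins.length * m + m) := fun c' hc' =>
      ((ih K c' hK (by omega)).congr fun u _ => by rw [hc' u]).mono (by omega)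
    by_cases hc : c.1 = 1
    · exact stay c fun u => by simp [Machine.step, hc]
    rcases ha : M.action (c.1, c.2.1.read, c.2.2.read, b) with _ | ⟨q, a, e, v, w, call⟩
    · exact stay (1, c.2.1, c.2.2) fun u => by simp [Machine.step, hc, ha]
    · refine (Bound.oracleCall hn hp hD hK (by omega) ((c.2.2.write e).move w) call
        (W := fun t u => strToNat (readStr (coins.foldl (M.step u.1 p)
          (q, (c.2.1.write a).move v, t)).2.1.2) = u.2.val)
        fun K' hK' hl t => ih K' _ hK' (by omega)).congr fun u _ => ?_
      simp [Machine.step, hc, ha]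

/-- Shoup's bound on the probability of success of a generic algorithm, for a random encoding
function, a random secret and fixed coin flips. -/
theorem card_success_le (hn : 1 ≤ n) (hp : p ≤ 2 ^ n) (M : Machine) (coins : List Bool) :
    (p - (3 * coins.length + 3) ^ 2) * cnt (n := n) (p := p) [] (fun u =>
      strToNat (M.output u.1 p [u.1.str 1, u.1.str u.2.val] coins) = u.2.val) ≤
    (1 + (coins.length + 2) * (3 * coins.length + 3)) * ((2 ^ n).factorial * p) := by
  have hlen : cnt (n := n) (p := p) [] (fun _ => True) = (2 ^ n).factorial * p := by
    classical
    unfold cnt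
    have e : Fin (2 ^ n) ≃ List.Vector Bool n := Fintype.equivOfCardEq (by simp)
    simp [Agrees, ZMod.card, Fintype.card_equiv e]
  rw [← hlen]
  set m := 3 * coins.length + 3 with hm
  have hp1 : 1 < p := (Fact.out : p.Prime).one_lt
  have : Fact (1 < p) := ⟨hp1⟩
  have hb : 1 + (coins.length + 2) * m = 1 + coins.length * m + m + m := by ring
  rw [hb]
  refine Bound.answer (W := fun r u => strToNat (M.output u.1 p [r.getD [], u.1.str u.2.val] coins)
    = u.2.val) hn hp le_rfl ⟨by simp, by simp⟩ (by simp) (fun u => some (u.1.str 1))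
    (Or.inr ⟨0, 1, fun u _ => by simp [ZMod.val_one]⟩) fun K₁ hK₁ hl₁ t₁ => ?_
  simp only [List.length_nil] at hl₁
  refine Bound.answer (W := fun r u => strToNat (M.output u.1 p [t₁.getD [], r.getD []] coins)
    = u.2.val) hn hp le_rfl hK₁ (by omega) (fun u => some (u.1.str u.2.val))
    (Or.inr ⟨1, 0, fun u _ => by simp⟩) fun K₂ hK₂ hl₂ t₂ => ?_
  exact bound_foldl_step hn hp M le_rfl coins K₂ _ hK₂ (by omega)

end Knowledge

/-! ### A random encoding function defeats any short list of machines -/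

section Counting

variable {n : ℕ}

/-- The number of sequences of `T` coin flips with which `M` outputs `x` on `(p; σ(1), σ(x))`. -/
def coinCount (M : Machine) (T : ℕ) (σ : Encf n) (p x : ℕ) : ℕ :=
  ((Finset.univ : Finset (Fin T → Bool)).filter fun r =>
    strToNat (M.output σ p [σ.str 1, σ.str x] (List.ofFn r)) = x).card

theorem coinProb_eq (M : Machine) (T : ℕ) (σ : Encf n) (p x : ℕ) :
    coinProb M T σ p x = (coinCount M T σ p x : ℚ) / 2 ^ T := rfl

/-- The number of successes of `M` within `T` steps, over all primes, secrets and coin flips. -/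
def successCount (M : Machine) (T : ℕ) (σ : Encf n) : ℕ :=
  ∑ p ∈ bitPrimes n, ∑ x ∈ Finset.range p, coinCount M T σ p x

theorem mem_bitPrimes {p : ℕ} :
    p ∈ bitPrimes n ↔ (2 ^ (n - 1) ≤ p ∧ p < 2 ^ n) ∧ p.Prime := by
  simp [bitPrimes]

theorem length_bin {p : ℕ} (hn : 1 ≤ n) (h : 2 ^ (n - 1) ≤ p) (h' : p < 2 ^ n) :
    (bin p).length = n := by
  rw [bin, List.length_reverse, Nat.size_eq_bits_len]
  have h1 := Nat.size_le.2 h'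
  have h2 := Nat.lt_size.2 h
  omega

theorem length_inputCells {p x : ℕ} (hn : 1 ≤ n) (hp : p ∈ bitPrimes n) (hx : x < p)
    (σ : Encf n) : (inputCells p [σ.str 1, σ.str x]).length = 4 * n + 5 := by
  obtain ⟨⟨h1, h2⟩, h3⟩ := mem_bitPrimes.1 hp
  have hb := length_bin hn h1 h2
  have e1 := σ.length_str (h3.one_lt.trans h2)
  have e2 := σ.length_str (hx.trans h2)
  simp only [inputCells, Nat.primeFactorsList_prime h3, cells, List.length_append, List.length_map,
    List.flatMap_cons, List.flatMap_nil, List.length_cons, List.length_nil, hb, e1, e2]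
  ring

/-- The number of steps of the `i`th polynomial-time generic algorithm on the inputs for `n`. -/
def steps (n i : ℕ) : ℕ := (4 * n + 5) ^ i + i

theorem dlogProb_eq_sum (hn : 1 ≤ n) (M : Machine) (t : ℕ → ℕ) (σ : Encf n) :
    dlogProb M t σ = (∑ p ∈ bitPrimes n,
      (∑ x ∈ Finset.range p, coinProb M (t (4 * n + 5)) σ p x) / p) / (bitPrimes n).card := by
  unfold dlogProb
  refine congrArg (· / _) (Finset.sum_congr rfl fun p hp => congrArg (· / _)
    (Finset.sum_congr rfl fun x hx => ?_))
  rw [length_inputCells hn hp (Finset.mem_range.1 hx)]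

/-- The hypothesis replaces the varying denominators `p` by their lower bound `2 ^ (n - 1)`, so that
it is a statement about natural numbers. -/
theorem dlogProbEnum_le_of_successCount (hn : 1 ≤ n) {i K : ℕ} {σ : Encf n}
    (h : n ^ K * successCount (machine i) (steps n i) σ ≤
      2 ^ (n - 1) * 2 ^ steps n i * (bitPrimes n).card) :
    dlogProbEnum i σ ≤ 1 / (n : ℚ) ^ K := by
  unfold dlogProbEnum
  rw [dlogProb_eq_sum hn]
  change (∑ p ∈ bitPrimes n, (∑ x ∈ Finset.range p, coinProb (machine i) (steps n i) σ p x) / p) /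
    _ ≤ _
  set T := steps n i
  have hn' : (0 : ℚ) < (n : ℚ) ^ K := by positivity
  rcases Nat.eq_zero_or_pos (bitPrimes n).card with h0 | h0
  · rw [h0]
    simp
  have h0' : (0 : ℚ) < (bitPrimes n).card := by exact_mod_cast h0
  rw [div_le_div_iff₀ h0' hn', one_mul]
  have key : ∑ p ∈ bitPrimes n,
      (∑ x ∈ Finset.range p, coinProb (machine i) T σ p x) / (p : ℚ) ≤
      (successCount (machine i) T σ : ℚ) / (2 ^ (n - 1) * 2 ^ T) := by
    unfold successCount
    push_cast
    rw [Finset.sum_div]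
    refine Finset.sum_le_sum fun p hp => ?_
    simp only [coinProb_eq]
    rw [← Finset.sum_div, div_div, mul_comm ((2 : ℚ) ^ T)]
    have : ((2 ^ (n - 1) : ℕ) : ℚ) ≤ p := by exact_mod_cast (mem_bitPrimes.1 hp).1.1
    push_cast at this
    gcongr
  have h' : (n : ℚ) ^ K * (successCount (machine i) T σ : ℚ) ≤
    2 ^ (n - 1) * 2 ^ T * (bitPrimes n).card := by exact_mod_cast h
  calc _ ≤ (successCount (machine i) T σ : ℚ) / (2 ^ (n - 1) * 2 ^ T) * n ^ K := by gcongr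
    _ = ((n : ℚ) ^ K * (successCount (machine i) T σ : ℚ)) / (2 ^ (n - 1) * 2 ^ T) := by ring
    _ ≤ _ := by
      rw [div_le_iff₀ (by positivity)]
      linarith

theorem sum_range_eq_sum_zmod (p : ℕ) [NeZero p] (f : ℕ → ℕ) :
    ∑ x ∈ Finset.range p, f x = ∑ x : ZMod p, f x.val := by
  refine Finset.sum_nbij' (fun k => (k : ZMod p)) ZMod.val ?_ ?_ ?_ ?_ ?_
  · simp
  · intro x _
    simpa using ZMod.val_lt x
  · intro k hk
    exact ZMod.val_natCast_of_lt (Finset.mem_range.1 hk)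
  · intro x _
    simp
  · intro k hk
    rw [ZMod.val_natCast_of_lt (Finset.mem_range.1 hk)]

/-- The bound on the probability of success, added up over all coin flips. -/
theorem sum_coinCount_le (hn : 1 ≤ n) {p : ℕ} (hp : p.Prime) (hpn : p ≤ 2 ^ n) (M : Machine)
    (T : ℕ) :
    (p - (3 * T + 3) ^ 2) * ∑ σ : Encf n, ∑ x ∈ Finset.range p, coinCount M T σ p x ≤
      (1 + (T + 2) * (3 * T + 3)) * ((2 ^ n).factorial * p) * 2 ^ T := by
  classical
  have : Fact p.Prime := ⟨hp⟩
  have e : ∑ σ : Encf n, ∑ x ∈ Finset.range p, coinCount M T σ p x =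
      ∑ r : Fin T → Bool, cnt (n := n) (p := p) [] (fun u =>
        strToNat (M.output u.1 p [u.1.str 1, u.1.str u.2.val] (List.ofFn r)) = u.2.val) := by
    simp only [sum_range_eq_sum_zmod]
    rw [← Fintype.sum_prod_type']
    have := Finset.sum_card_bipartiteAbove_eq_sum_card_bipartiteBelow
      (s := (Finset.univ : Finset (Encf n × ZMod p)))
      (t := (Finset.univ : Finset (Fin T → Bool)))
      (fun u r => strToNat (M.output u.1 p [u.1.str 1, u.1.str u.2.val] (List.ofFn r)) = u.2.val)
    refine (Eq.trans ?_ this).trans ?_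
    · rfl
    · refine Finset.sum_congr rfl fun r _ => ?_
      unfold cnt Finset.bipartiteBelow
      congr 1
      ext u
      simp [Agrees]
  rw [e, Finset.mul_sum]
  refine (Finset.sum_le_card_nsmul _ _ ((1 + (T + 2) * (3 * T + 3)) * ((2 ^ n).factorial * p))
    fun r _ => ?_).trans ?_
  · have := card_success_le hn hpn M (List.ofFn r)
    simpa using this
  · simp [mul_comm]

/-- If `T ^ 2` is small compared with `2 ^ n`, then the denominator `p - (3 * T + 3) ^ 2` is at
least `2 ^ (n - 2)` for all `n`-bit primes `p`. -/
theorem sum_successCount_le (hn : 2 ≤ n) (M : Machine) (T : ℕ)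
    (hT : (3 * T + 3) ^ 2 ≤ 2 ^ (n - 2)) :
    ∑ σ : Encf n, successCount M T σ ≤
      4 * (1 + (T + 2) * (3 * T + 3)) * (2 ^ n).factorial * 2 ^ T * (bitPrimes n).card := by
  have h4 : 2 ^ n = 4 * 2 ^ (n - 2) := by
    rw [show (4 : ℕ) = 2 ^ 2 by norm_num, ← pow_add]
    congr 1
    omega
  have h2 : 2 ^ (n - 1) = 2 * 2 ^ (n - 2) := by
    rw [← pow_succ']
    congr 1
    omega
  refine Nat.le_of_mul_le_mul_left (c := 2 ^ (n - 2)) ?_ (by positivity)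
  unfold successCount
  rw [Finset.sum_comm, Finset.mul_sum]
  refine (Finset.sum_le_card_nsmul _ _ ((1 + (T + 2) * (3 * T + 3)) * ((2 ^ n).factorial * 2 ^ n) *
    2 ^ T) fun p hp => ?_).trans ?_
  · obtain ⟨⟨h1, h1'⟩, h3⟩ := mem_bitPrimes.1 hp
    calc _ ≤ (p - (3 * T + 3) ^ 2) * _ := Nat.mul_le_mul_right _ (by omega)
      _ ≤ _ := sum_coinCount_le (by omega) h3 h1'.le M T
      _ ≤ _ := by gcongr
  · rw [smul_eq_mul]
    generalize (2 ^ n).factorial = N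
    rw [h4]
    apply le_of_eq
    ring

/-- If the bounds for the first `K` machines add up to less than 1, then some encoding function
is good for all of them. -/
theorem exists_forall_successCount_le (hn : 2 ≤ n) (K E : ℕ)
    (hT : ∀ i < K, (3 * steps n i + 3) ^ 2 ≤ 2 ^ (n - 2))
    (hβ : ∀ i < K, 1 + (steps n i + 2) * (3 * steps n i + 3) ≤ E)
    (hE : K * (4 * E * n ^ K) < 2 ^ (n - 1)) :
    ∃ σ : Encf n, ∀ i < K, n ^ K * successCount (machine i) (steps n i) σ ≤
      2 ^ (n - 1) * 2 ^ steps n i * (bitPrimes n).card := by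
  classical
  by_contra! hbad
  let Bad : ℕ → Finset (Encf n) := fun i => Finset.univ.filter fun σ =>
    2 ^ (n - 1) * 2 ^ steps n i * (bitPrimes n).card <
      n ^ K * successCount (machine i) (steps n i) σ
  have hcov : (Finset.univ : Finset (Encf n)) ⊆ (Finset.range K).biUnion Bad := by
    intro σ _
    obtain ⟨i, hi, h⟩ := hbad σ
    simp only [Finset.mem_biUnion, Finset.mem_range]
    exact ⟨i, hi, by simpa [Bad] using h⟩
  have hcard : Fintype.card (Encf n) = (2 ^ n).factorial := by
    have e : Fin (2 ^ n) ≃ List.Vector Bool n := Fintype.equivOfCardEq (by simp)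
    simp [Fintype.card_equiv e]
  have hB : ∀ i < K, (Bad i).card * 2 ^ (n - 1) ≤ 4 * E * n ^ K * (2 ^ n).factorial := by
    intro i hi
    set T := steps n i with hTdef
    rcases Nat.eq_zero_or_pos (bitPrimes n).card with h0 | h0
    · have : Bad i = ∅ := by
        refine Finset.filter_eq_empty_iff.2 fun σ _ => ?_
        rw [Finset.card_eq_zero] at h0
        simp [successCount, h0]
      simp [this]
    · have hpos : 0 < 2 ^ T * (bitPrimes n).card := by positivity
      refine Nat.le_of_mul_le_mul_right ?_ hpos
      calc (Bad i).card * 2 ^ (n - 1) * (2 ^ T * (bitPrimes n).card)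
          = ∑ σ ∈ Bad i, 2 ^ (n - 1) * 2 ^ T * (bitPrimes n).card := by
            rw [Finset.sum_const, smul_eq_mul]
            ring
        _ ≤ ∑ σ ∈ Bad i, n ^ K * successCount (machine i) T σ :=
            Finset.sum_le_sum fun σ hσ => by
              simp only [Bad, Finset.mem_filter] at hσ
              exact hσ.2.le
        _ ≤ ∑ σ : Encf n, n ^ K * successCount (machine i) T σ :=
            Finset.sum_le_sum_of_subset (Finset.subset_univ _)
        _ = n ^ K * ∑ σ : Encf n, successCount (machine i) T σ := by rw [Finset.mul_sum]
        _ ≤ n ^ K * (4 * E * (2 ^ n).factorial * 2 ^ T * (bitPrimes n).card) := by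
            have h1 := sum_successCount_le hn (machine i) T (hT i hi)
            have h2 := hβ i hi
            refine Nat.mul_le_mul_left _ (h1.trans ?_)
            gcongr
        _ = _ := by ring
  have h1 : (2 ^ n).factorial ≤ ∑ i ∈ Finset.range K, (Bad i).card := by
    rw [← hcard, ← Finset.card_univ]
    exact (Finset.card_le_card hcov).trans Finset.card_biUnion_le
  have h2 : (2 ^ n).factorial * 2 ^ (n - 1) ≤ K * (4 * E * n ^ K) * (2 ^ n).factorial := by
    calc _ ≤ (∑ i ∈ Finset.range K, (Bad i).card) * 2 ^ (n - 1) := Nat.mul_le_mul_right _ h1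
      _ = ∑ i ∈ Finset.range K, (Bad i).card * 2 ^ (n - 1) := Finset.sum_mul _ _ _
      _ ≤ ∑ i ∈ Finset.range K, 4 * E * n ^ K * (2 ^ n).factorial :=
          Finset.sum_le_sum fun i hi => hB i (Finset.mem_range.1 hi)
      _ = _ := by
          rw [Finset.sum_const, Finset.card_range, smul_eq_mul]
          ring
  have h3 := Nat.mul_lt_mul_of_pos_right hE (Nat.factorial_pos (2 ^ n))
  rw [mul_comm] at h2
  omega

/-- The number of machines against which the encoding function for `n` is chosen, which is also the
exponent that bounds their probability of success. It grows so slowly that the running times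
`steps n i` are small compared with `2 ^ n`. -/
def level (n : ℕ) : ℕ := Nat.log 2 n - 20

theorem quadratic_le_two_pow {a : ℕ} (ha : 21 ≤ a) : 3 * a ^ 2 + 10 * a + 9 ≤ 2 ^ a := by
  induction a, ha using Nat.le_induction with
  | base => norm_num
  | succ a ha ih =>
    rw [pow_succ 2]
    nlinarith

/-- For every `n` there is an encoding function against which each of the first `level n` machines
has probability of success at most `1 / n ^ level n`. -/
theorem exists_good_encf (n : ℕ) : ∃ σ : Encf n, ∀ i < level n,
    n ^ level n * successCount (machine i) (steps n i) σ ≤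
      2 ^ (n - 1) * 2 ^ steps n i * (bitPrimes n).card := by
  -- For `n < 2 ^ 21` there is nothing to show. Otherwise, all quantities are bounded by powers of 2
  -- whose exponents are quadratic in `a = log₂ n`.
  rcases Nat.eq_zero_or_pos (level n) with h0 | h0
  · exact ⟨Fintype.equivOfCardEq (by simp), by simp [h0]⟩
  set a := Nat.log 2 n with ha
  have hK : level n = a - 20 := rfl
  have ha21 : 21 ≤ a := by omega
  have hn0 : n ≠ 0 := by
    rintro rfl
    simp [ha] at ha21
  have hlo : 2 ^ a ≤ n := Nat.pow_log_le_self 2 hn0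
  have hhi : n < 2 ^ (a + 1) := Nat.lt_pow_succ_log_self (by norm_num) n
  have hq := quadratic_le_two_pow ha21
  have h5 : 4 * n + 5 ≤ 2 ^ (a + 4) := by
    have h8 : 1 ≤ 2 ^ a := Nat.one_le_two_pow
    rw [pow_add] at hhi ⊢
    omega
  have hsteps : ∀ i < level n, steps n i + 2 ≤ 2 ^ (a ^ 2 + 4 * a + 1) := by
    intro i hi
    have h1 : (4 * n + 5) ^ i ≤ 2 ^ (a ^ 2 + 4 * a) := by
      calc (4 * n + 5) ^ i ≤ (2 ^ (a + 4)) ^ i := Nat.pow_le_pow_left h5 i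
        _ = 2 ^ ((a + 4) * i) := by rw [← pow_mul]
        _ ≤ 2 ^ (a ^ 2 + 4 * a) := by
          refine Nat.pow_le_pow_right (by norm_num) ?_
          have : i ≤ a := by omega
          nlinarith
    have h2 : a < 2 ^ a := Nat.lt_two_pow_self
    have h3 : 2 ^ a ≤ 2 ^ (a ^ 2 + 4 * a) := Nat.pow_le_pow_right (by norm_num) (by nlinarith)
    rw [pow_succ]
    unfold steps
    omega
  have hm : ∀ i < level n, 3 * steps n i + 3 ≤ 2 ^ (a ^ 2 + 4 * a + 3) := by
    intro i hi
    have := hsteps i hi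
    rw [pow_add] at this ⊢
    omega
  refine exists_forall_successCount_le (by omega) (level n) (2 ^ (2 * a ^ 2 + 8 * a + 5)) ?_ ?_ ?_
  · intro i hi
    calc (3 * steps n i + 3) ^ 2 ≤ (2 ^ (a ^ 2 + 4 * a + 3)) ^ 2 := Nat.pow_le_pow_left (hm i hi) 2
      _ = 2 ^ (2 * a ^ 2 + 8 * a + 6) := by
        rw [← pow_mul]
        congr 1
        ring
      _ ≤ _ := Nat.pow_le_pow_right (by norm_num) (by
        have : 21 * a ≤ a ^ 2 := by nlinarith
        omega)
  · intro i hi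
    calc 1 + (steps n i + 2) * (3 * steps n i + 3)
        ≤ 2 ^ (2 * a ^ 2 + 8 * a + 4) + 2 ^ (a ^ 2 + 4 * a + 1) * 2 ^ (a ^ 2 + 4 * a + 3) :=
          Nat.add_le_add Nat.one_le_two_pow (Nat.mul_le_mul (hsteps i hi) (hm i hi))
      _ = 2 ^ (2 * a ^ 2 + 8 * a + 5) := by
        rw [← pow_add, pow_succ _ (2 * a ^ 2 + 8 * a + 4), mul_two]
        congr 2
        ring
  · have hKa : level n ≤ a := by omega
    calc level n * (4 * 2 ^ (2 * a ^ 2 + 8 * a + 5) * n ^ level n)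
        ≤ 2 ^ a * (2 ^ 2 * 2 ^ (2 * a ^ 2 + 8 * a + 5) * (2 ^ (a + 1)) ^ a) := by
          refine Nat.mul_le_mul (hKa.trans Nat.lt_two_pow_self.le) (Nat.mul_le_mul (by norm_num) ?_)
          exact (Nat.pow_le_pow_left hhi.le _).trans (Nat.pow_le_pow_right (by positivity) hKa)
      _ = 2 ^ (3 * a ^ 2 + 10 * a + 7) := by
        rw [← pow_mul, ← pow_add, ← pow_add, ← pow_add]
        congr 1
        ring
      _ < _ := Nat.pow_lt_pow_right (by norm_num) (by omega)

end Counting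

/-! ### From effective hardness to hardness -/

section Hardness

variable {n : ℕ}

/-- A coin flip after the machine has halted has no effect. -/
theorem coinCount_succ (M : Machine) {T : ℕ} (σ : Encf n) {p x : ℕ}
    (h : ∀ coins : List Bool, coins.length = T →
      (M.run σ p [σ.str 1, σ.str x] coins).1 = 1) :
    coinCount M (T + 1) σ p x = 2 * coinCount M T σ p x := by
  unfold coinCount
  rw [← Fintype.card_bool, ← Finset.card_univ, ← Finset.card_product]
  refine (Finset.card_equiv (Fin.snocEquiv fun _ => Bool) ?_).symm
  rintro ⟨b, r⟩
  have : M.output σ p [σ.str 1, σ.str x] (List.ofFn (Fin.snocEquiv (fun _ => Bool) (b, r))) =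
      M.output σ p [σ.str 1, σ.str x] (List.ofFn r) := by
    have e : List.ofFn (Fin.snocEquiv (fun _ => Bool) (b, r)) = List.ofFn r ++ [b] := by
      rw [List.ofFn_succ']
      simp [Fin.snocEquiv]
    have h1 := h (List.ofFn r) (by simp)
    unfold Machine.output
    rw [e]
    unfold Machine.run at h1 ⊢
    rw [List.foldl_append, List.foldl_cons, List.foldl_nil, Machine.step, if_pos h1]
  simp only [Finset.mem_product, Finset.mem_univ, Finset.mem_filter, true_and, this]

theorem coinProb_eq_of_halted (M : Machine) {T T' : ℕ} (hT : T ≤ T') (σ : Encf n) {p x : ℕ}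
    (h : ∀ coins : List Bool, coins.length = T →
      (M.run σ p [σ.str 1, σ.str x] coins).1 = 1) :
    coinProb M T' σ p x = coinProb M T σ p x := by
  have hpersist : ∀ d, ∀ coins : List Bool, coins.length = T + d →
      (M.run σ p [σ.str 1, σ.str x] coins).1 = 1 := by
    intro d
    induction d with
    | zero => exact h
    | succ d ih =>
      intro coins hc
      obtain ⟨cs, b, rfl⟩ : ∃ cs b, coins = cs ++ [b] := by
        rcases List.eq_nil_or_concat coins with rfl | ⟨cs, b, rfl⟩
        · simp at hc
        · exact ⟨cs, b, by simp⟩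
      have h1 := ih cs (by simp at hc; omega)
      unfold Machine.run at h1 ⊢
      rw [List.foldl_append, List.foldl_cons, List.foldl_nil, Machine.step, if_pos h1]
      exact h1
  induction T', hT using Nat.le_induction with
  | base => rfl
  | succ T' hT' ih =>
    rw [← ih, coinProb_eq, coinProb_eq, coinCount_succ M σ (by
      have := hpersist (T' - T)
      rwa [Nat.add_sub_cancel' hT'] at this)]
    push_cast
    rw [pow_succ]
    field_simp

/-- The restriction to `2 ≤ L` is needed, since a constant polynomial may exceed all
powers of 0 and 1. -/
theorem eval_le_pow (P : Polynomial ℕ) : ∃ k₀, ∀ k, k₀ ≤ k → ∀ L, 2 ≤ L → P.eval L ≤ L ^ k := by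
  refine ⟨P.natDegree + P.eval 1, fun k hk L hL => ?_⟩
  calc P.eval L = ∑ i ∈ Finset.range (P.natDegree + 1), P.coeff i * L ^ i :=
        Polynomial.eval_eq_sum_range L
    _ ≤ ∑ i ∈ Finset.range (P.natDegree + 1), P.coeff i * L ^ P.natDegree := by
        refine Finset.sum_le_sum fun i hi => Nat.mul_le_mul_left _ ?_
        exact Nat.pow_le_pow_right (by omega) (by have := Finset.mem_range.1 hi; omega)
    _ = P.eval 1 * L ^ P.natDegree := by
        rw [← Finset.sum_mul, Polynomial.eval_eq_sum_range]
        simp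
    _ ≤ L ^ P.eval 1 * L ^ P.natDegree := by
        refine Nat.mul_le_mul_right _ (Nat.lt_two_pow_self.le.trans (Nat.pow_le_pow_left hL _))
    _ = L ^ (P.natDegree + P.eval 1) := by rw [← pow_add, add_comm]
    _ ≤ L ^ k := Nat.pow_le_pow_right (by omega) hk

/-- Each machine has arbitrarily large indices, and thus some index for which the enumerated
algorithm does not stop it early. -/
theorem EffectivelyHard.hard {σ : Family} (h : EffectivelyHard σ) : Hard σ := by
  obtain ⟨f, -, hf⟩ := h
  intro M P hM d hd
  obtain ⟨k₀, hk₀⟩ := eval_le_pow P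
  set i := Nat.pair (Encodable.encode M) (k₀ + 1) with hi
  have hle : k₀ + 1 ≤ i := Nat.right_le_pair _ _
  have hmach : machine i = M := by simp [machine, hi]
  refine ⟨f i d + 1, by omega, fun n hn => ?_⟩
  refine le_trans (le_of_eq ?_) (hf i d n (by omega) hd (by omega) (by omega))
  unfold dlogProbEnum
  rw [dlogProb_eq_sum (by omega), dlogProb_eq_sum (by omega), hmach]
  refine congrArg (· / _) (Finset.sum_congr rfl fun p hp => congrArg (· / _)
    (Finset.sum_congr rfl fun x hx => ?_))
  obtain ⟨⟨h1, h2⟩, h3⟩ := mem_bitPrimes.1 hp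
  have hx := Finset.mem_range.1 hx
  symm
  refine coinProb_eq_of_halted M ?_ _ fun coins hc => ?_
  · exact (hk₀ i (by omega) _ (by omega)).trans (Nat.le_add_right _ _)
  · refine hM n (σ n) p [1, x] (by omega) h3.one_lt.le h2.le ?_ coins ?_
    · intro y hy
      simp only [List.mem_cons, List.not_mem_nil, or_false] at hy
      rcases hy with rfl | rfl
      · exact h3.one_lt
      · exact hx
    · rw [hc]
      congr 1
      exact (length_inputCells (by omega) hp hx (σ n)).symm

end Hardness

/-! ### The experiment on tables of strings -/

section Tables

/-- `Encf.log`, for an encoding function that is given as the list of its values; the pair `e`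
consists of this list and the group order. -/
def tabLog (e : List Str × ℕ) (s : Str) : Option ℕ :=
  if e.1.idxOf s < e.2 then some (e.1.idxOf s) else none

/-- `Encf.add` for tables. -/
def tabAdd (e : List Str × ℕ) (q : Str × Str) : Option Str :=
  (tabLog e q.1).bind fun a => (tabLog e q.2).map fun b => e.1.getD ((a + b) % e.2) []

/-- `Encf.inv` for tables. -/
def tabInv (e : List Str × ℕ) (s : Str) : Option Str :=
  (tabLog e s).map fun a => e.1.getD ((e.2 - a) % e.2) []

/-- `oracleCall` for tables. -/
def tabCall (e : List Str × ℕ) (t : Tape) (call : Option Bool) : Tape :=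
  Option.casesOn call t fun b =>
    ([], cells ((bif b then tabInv e (readStr t.2) else
      tabAdd e (readStr t.2, readStr (t.2.drop ((readStr t.2).length + 1)))).getD []))

/-- `Machine.step` for tables. -/
def tabStep (e : Machine × List Str × ℕ) (c : Config) (b : Bool) : Config :=
  if c.1 = 1 then c else
    ((List.lookup (c.1, c.2.1.read, c.2.2.read, b) e.1).map fun r =>
      (r.1, (c.2.1.write r.2.1).move r.2.2.2.1,
        tabCall e.2 ((c.2.2.write r.2.2.1).move r.2.2.2.2.1) r.2.2.2.2.2)).getD
      (1, c.2.1, c.2.2)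

/-- The binary representation of a number with `n` bits. -/
def binOfSize (n p : ℕ) : Str := (List.range n).reverse.map fun j => decide (p / 2 ^ j % 2 = 1)

/-- The input of a generic algorithm for an `n`-bit prime `p` and two encoded group elements. -/
def tabInput (n p : ℕ) (s t : Str) : List ℕ :=
  cells (binOfSize n p) ++ 3 :: (cells (binOfSize n p) ++ 3 :: 3 ::
    (cells s ++ 3 :: (cells t ++ [3])))

/-- The output of a machine on input `(p; σ(1), σ(x))`, where `a = (n, p, x)`, for tables. -/
def tabOutput (M : Machine) (l : List Str) (a : ℕ × ℕ × ℕ) (coins : List Bool) : Str :=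
  readStr (coins.foldl (tabStep (M, l, a.2.1))
    (0, ([], tabInput a.1 a.2.1 (l.getD 1 []) (l.getD a.2.2 [])), ([], []))).2.1.2

/-- All sequences of `T` coin flips. -/
def coinLists (T : ℕ) : List (List Bool) :=
  Nat.rec [[]] (fun _ L => L.map (List.cons false) ++ L.map (List.cons true)) T

/-- `successCount` for tables, where `q = (n, i, l)`: the machine is the `i`th one, and runs for
`steps n i` steps. -/
def tabSuccessCount (q : ℕ × ℕ × List Str) : ℕ :=
  ((List.range (2 ^ q.1)).map fun p =>
    if 2 ^ (q.1 - 1) ≤ p ∧ p.Prime then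
      ((List.range p).map fun x =>
        ((coinLists (steps q.1 q.2.1)).map fun r =>
          if strToNat (tabOutput (machine q.2.1) q.2.2 (q.1, p, x) r) = x then 1 else 0).sum).sum
    else 0).sum

/-- The number of `n`-bit primes. -/
def tabPrimeCount (n : ℕ) : ℕ :=
  ((List.range (2 ^ n)).map fun p => if 2 ^ (n - 1) ≤ p ∧ p.Prime then 1 else 0).sum

/-- The list `l` is the table of an encoding function into `n` bitstrings against which none of the
first `level n` machines succeeds too often. The condition on `idxOf` says that the entries are
distinct. -/
def GoodTable (n : ℕ) (l : List Str) : Prop :=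
  (l.length = 2 ^ n ∧ (∀ j < l.length, l.idxOf (l.getD j []) = j) ∧ ∀ s ∈ l, s.length = n) ∧
    ∀ i < level n, n ^ level n * tabSuccessCount (n, i, l) ≤
      2 ^ (n - 1) * 2 ^ steps n i * tabPrimeCount n

variable {n : ℕ}

/-- The list of the values of an encoding function. -/
def Encf.table (σ : Encf n) : List Str := List.ofFn fun x => (σ x).toList

theorem Encf.length_table (σ : Encf n) : σ.table.length = 2 ^ n := by simp [Encf.table]

theorem Encf.getD_table (σ : Encf n) (k : ℕ) : σ.table.getD k [] = σ.str k := by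
  by_cases h : k < 2 ^ n
  · rw [List.getD_eq_getElem _ _ (by rwa [σ.length_table]), σ.str_of_lt h]
    simp [Encf.table]
  · rw [List.getD_eq_default _ _ (by rw [σ.length_table]; omega)]
    simp [Encf.str, h]

theorem Encf.idxOf_table (σ : Encf n) {k : ℕ} (hk : k < 2 ^ n) : σ.table.idxOf (σ.str k) = k := by
  have hnd : σ.table.Nodup :=
    List.nodup_ofFn.2 fun x y h => σ.injective (List.Vector.toList_injective h)
  have hk' : k < σ.table.length := by rwa [σ.length_table]
  rw [← σ.getD_table, List.getD_eq_getElem _ _ hk']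
  exact hnd.idxOf_getElem k hk'

theorem tabLog_table (σ : Encf n) {N : ℕ} (hN : N ≤ 2 ^ n) (s : Str) :
    tabLog (σ.table, N) s = σ.log N s := by
  unfold tabLog
  split_ifs with h
  · dsimp only at h ⊢
    have h1 : σ.table.idxOf s < σ.table.length := by
      rw [σ.length_table]
      omega
    have h2 : σ.str (σ.table.idxOf s) = s := by
      rw [← σ.getD_table, List.getD_eq_getElem _ _ h1, List.getElem_idxOf]
    conv_rhs => rw [← h2]
    exact (σ.log_eq_some hN h).symm
  · refine (σ.log_eq_none fun k hk e => h ?_).symm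
    rw [← e]
    dsimp only
    rw [σ.idxOf_table (hk.trans_le hN)]
    exact hk

theorem tabCall_table (σ : Encf n) {N : ℕ} (hN : N ≤ 2 ^ n) (t : Tape) (call : Option Bool) :
    tabCall (σ.table, N) t call = oracleCall σ N t call := by
  rcases call with _ | _ | _
  · rfl
  · simp only [tabCall, oracleCall, cond_false, tabAdd, Encf.add, tabLog_table σ hN, σ.getD_table]
    rcases σ.log N (readStr t.2) with _ | a
    · rfl
    · rcases σ.log N (readStr (t.2.drop ((readStr t.2).length + 1))) with _ | b <;> rfl
  · simp only [tabCall, oracleCall, cond_true, tabInv, Encf.inv, tabLog_table σ hN, σ.getD_table]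

theorem Machine.action_eq_lookup (M : Machine) (k : ℕ × ℕ × ℕ × Bool) :
    M.action k = List.lookup k M := by
  induction M with
  | nil => rfl
  | cons r M ih =>
    obtain ⟨k', v⟩ := r
    unfold Machine.action at ih ⊢
    by_cases h : k = k'
    · subst h
      simp
    · have h1 : (k' == k) = false := by simpa using Ne.symm h
      have h2 : (k == k') = false := by simpa using h
      simp only [List.find?_cons, h1, List.lookup_cons, h2]
      exact ih

theorem tabStep_table (M : Machine) (σ : Encf n) {N : ℕ} (hN : N ≤ 2 ^ n) :
    tabStep (M, σ.table, N) = M.step σ N := by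
  funext c b
  unfold tabStep Machine.step
  split_ifs with h
  · rfl
  · rw [Machine.action_eq_lookup]
    dsimp only
    rcases List.lookup (c.1, c.2.1.read, c.2.2.read, b) M with _ | r
    · rfl
    · simp [tabCall_table σ hN]

theorem binOfSize_eq {p : ℕ} (hn : 1 ≤ n) (h : 2 ^ (n - 1) ≤ p) (h' : p < 2 ^ n) :
    binOfSize n p = bin p := by
  have hl := length_bin hn h h'
  have e : p.bits = (List.range n).map fun j => decide (p / 2 ^ j % 2 = 1) := by
    have hl' : p.bits.length = n := by simpa [bin] using hl
    refine List.ext_getElem (by simp [hl']) fun j h1 h2 => ?_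
    have := Nat.testBit_eq_inth p j
    rw [List.getI_eq_getElem _ h1] at this
    rw [← this, Nat.testBit_eq_decide_div_mod_eq]
    simp
  rw [bin, e, binOfSize, List.map_reverse]

theorem tabOutput_table (M : Machine) (σ : Encf n) {p : ℕ} (hn : 1 ≤ n) (hp : p ∈ bitPrimes n)
    (x : ℕ) (coins : List Bool) :
    tabOutput M σ.table (n, p, x) coins = M.output σ p [σ.str 1, σ.str x] coins := by
  obtain ⟨⟨h1, h2⟩, h3⟩ := mem_bitPrimes.1 hp
  have e : tabInput n p (σ.str 1) (σ.str x) = inputCells p [σ.str 1, σ.str x] := by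
    simp [tabInput, inputCells, Nat.primeFactorsList_prime h3, binOfSize_eq hn h1 h2]
  unfold tabOutput Machine.output Machine.run
  dsimp only
  rw [σ.getD_table, σ.getD_table, e, tabStep_table M σ h2.le]

theorem sum_map_coinLists (T : ℕ) (g : List Bool → ℕ) :
    ((coinLists T).map g).sum = ∑ r : Fin T → Bool, g (List.ofFn r) := by
  induction T generalizing g with
  | zero => simp [coinLists]
  | succ T ih =>
    have e : coinLists (T + 1) =
      (coinLists T).map (List.cons false) ++ (coinLists T).map (List.cons true) := rfl
    rw [e, List.map_append, List.sum_append, List.map_map, List.map_map, ih, ih,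
      ← (Fin.consEquiv fun _ : Fin (T + 1) => Bool).sum_comp, Fintype.sum_prod_type,
      Fintype.sum_bool, add_comm]
    simp [Fin.consEquiv]

theorem sum_map_range (N : ℕ) (g : ℕ → ℕ) :
    ((List.range N).map g).sum = ∑ k ∈ Finset.range N, g k := by
  induction N with
  | zero => rfl
  | succ N ih => rw [List.range_succ, Finset.sum_range_succ, ← ih]; simp

theorem sum_bitPrimes (n : ℕ) (g : ℕ → ℕ) :
    ((List.range (2 ^ n)).map fun p => if 2 ^ (n - 1) ≤ p ∧ p.Prime then g p else 0).sum =
      ∑ p ∈ bitPrimes n, g p := by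
  rw [sum_map_range, ← Finset.sum_filter]
  refine Finset.sum_congr ?_ fun _ _ => rfl
  ext p
  rw [mem_bitPrimes, Finset.mem_filter, Finset.mem_range]
  tauto

theorem tabPrimeCount_eq (n : ℕ) : tabPrimeCount n = (bitPrimes n).card := by
  rw [tabPrimeCount, sum_bitPrimes n fun _ => 1]
  simp

theorem tabSuccessCount_table (hn : 1 ≤ n) (i : ℕ) (σ : Encf n) :
    tabSuccessCount (n, i, σ.table) = successCount (machine i) (steps n i) σ := by
  unfold tabSuccessCount successCount
  dsimp only
  rw [sum_bitPrimes n fun p => ((List.range p).map fun x =>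
        ((coinLists (steps n i)).map fun r =>
          if strToNat (tabOutput (machine i) σ.table (n, p, x) r) = x then 1 else 0).sum).sum]
  refine Finset.sum_congr rfl fun p hp => ?_
  rw [sum_map_range]
  refine Finset.sum_congr rfl fun x _ => ?_
  rw [sum_map_coinLists, coinCount, Finset.card_filter]
  refine Finset.sum_congr rfl fun r _ => ?_
  rw [tabOutput_table _ σ hn hp]

theorem level_zero : level 0 = 0 := by simp [level]

theorem exists_goodTable (n : ℕ) : ∃ l, GoodTable n l := by
  obtain ⟨σ, hσ⟩ := exists_good_encf n
  refine ⟨σ.table, ⟨σ.length_table, fun j hj => ?_, fun s hs => ?_⟩, fun i hi => ?_⟩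
  · rw [σ.length_table] at hj
    rw [σ.getD_table, σ.idxOf_table hj]
  · simp only [Encf.table, List.mem_ofFn] at hs
    obtain ⟨x, rfl⟩ := hs
    simp
  · rcases Nat.eq_zero_or_pos n with rfl | hn
    · simp [level_zero] at hi
    · rw [tabSuccessCount_table hn, tabPrimeCount_eq]
      exact hσ i hi

/-- A list of `2 ^ n` distinct strings of length `n` contains all of them. -/
theorem GoodTable.exists_encf {l : List Str} (h : GoodTable n l) : ∃ σ : Encf n, σ.table = l := by
  obtain ⟨⟨h1, h2, h3⟩, -⟩ := h
  let f : Fin (2 ^ n) → List.Vector Bool n := fun x =>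
    ⟨l[x.1]'(by rw [h1]; exact x.2), h3 _ (List.getElem_mem _)⟩
  have hf : Function.Injective f := by
    intro x y e
    have e' : l[x.1]'(by rw [h1]; exact x.2) = l[y.1]'(by rw [h1]; exact y.2) :=
      congrArg Subtype.val e
    have hx := h2 x (by rw [h1]; exact x.2)
    have hy := h2 y (by rw [h1]; exact y.2)
    rw [List.getD_eq_getElem _ _ (by rw [h1]; exact x.2)] at hx
    rw [List.getD_eq_getElem _ _ (by rw [h1]; exact y.2)] at hy
    exact Fin.ext (by rw [← hx, ← hy, e'])
  refine ⟨Equiv.ofBijective f ((Fintype.bijective_iff_injective_and_card f).2 ⟨hf, by simp⟩), ?_⟩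
  refine List.ext_getElem (by rw [Encf.length_table, h1]) fun j hj hj' => ?_
  simp only [Encf.table, List.getElem_ofFn, Equiv.ofBijective_apply]
  rfl

end Tables

/-! ### Computability of the search -/

section Computability

open Primrec

variable {α β : Type*} [Primcodable α] [Primcodable β]

theorem primrec_sum : Primrec (List.sum : List ℕ → ℕ) :=
  (list_foldr .id (const 0) (nat_add.comp (fst.comp snd) (snd.comp snd)).to₂).of_eq fun _ => rfl

theorem primrec_sum_map {f : α → List β} {g : α → β → ℕ} (hf : Primrec f) (hg : Primrec₂ g) :
    Primrec fun a => ((f a).map (g a)).sum :=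
  primrec_sum.comp (list_map hf hg)

/-- `Primrec.list_idxOf` for any lawful equality test. -/
theorem primrec_idxOf [BEq α] [LawfulBEq α] : Primrec₂ (List.idxOf : α → List α → ℕ) := by
  classical
  have e := lawful_beq_subsingleton ‹BEq α› instBEqOfDecidableEq
  subst e
  exact list_idxOf

/-- `Primrec.listLookup` for any lawful equality test. -/
theorem primrec_lookup [BEq α] [LawfulBEq α] :
    Primrec₂ (List.lookup : α → List (α × β) → Option β) := by
  classical
  have e := lawful_beq_subsingleton ‹BEq α› instBEqOfDecidableEq
  subst e
  exact listLookup

theorem primrec_pow : Primrec₂ ((· ^ ·) : ℕ → ℕ → ℕ) :=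
  Primrec₂.unpaired'.1 Nat.Primrec.pow

theorem primrec_headD : Primrec fun l : List ℕ => l.headD 0 :=
  (option_getD.comp list_head? (const 0)).of_eq fun l => by cases l <;> rfl

theorem primrec_cells : Primrec cells :=
  list_map .id ((dom_bool bitSym).comp snd).to₂

theorem primrec_readStr : Primrec readStr := by
  have h1 : Primrec fun a : ℕ => a == 1 := Primrec.beq.comp .id (const 1)
  have h2 : Primrec fun a : ℕ => a == 2 := Primrec.beq.comp .id (const 2)
  exact list_map (list_takeWhile (Primrec.or.comp h1 h2)) (h2.comp snd).to₂

theorem primrec_strToNat : Primrec strToNat := by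
  have h : Primrec fun q : ℕ × Bool => 2 * q.1 + q.2.toNat :=
    nat_add.comp (nat_double.comp fst) ((dom_bool Bool.toNat).comp snd)
  exact nat_sub.comp (list_foldl .id (const 1) (h.comp snd).to₂) (const 1)

theorem primrec_read : Primrec Tape.read := primrec_headD.comp snd

theorem primrec_write : Primrec₂ Tape.write :=
  Primrec.pair (fst.comp fst) (list_cons.comp snd (list_tail.comp (snd.comp fst)))

theorem primrec_move : Primrec₂ Tape.move := by
  have hl : Primrec fun t : Tape => ((t.1.tail, t.1.headD 0 :: t.2) : Tape) :=
    Primrec.pair (list_tail.comp fst) (list_cons.comp (primrec_headD.comp fst) snd)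
  have hr : Primrec fun t : Tape => ((t.2.headD 0 :: t.1, t.2.tail) : Tape) :=
    Primrec.pair (list_cons.comp (primrec_headD.comp snd) fst) (list_tail.comp snd)
  refine (option_casesOn (o := fun q : Tape × Option Bool => q.2) snd fst
    (cond snd (hr.comp (fst.comp fst)) (hl.comp (fst.comp fst))).to₂).of_eq ?_
  rintro ⟨t, _ | _ | _⟩ <;> rfl

theorem primrec_tabLog : Primrec₂ tabLog := by
  have h : Primrec fun q : (List Str × ℕ) × Str => q.1.1.idxOf q.2 :=
    primrec_idxOf.comp snd (fst.comp fst)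
  exact ite (nat_lt.comp h (snd.comp fst)) (option_some.comp h) (const none)

theorem primrec_tabAdd : Primrec₂ tabAdd := by
  refine option_bind (primrec_tabLog.comp fst (fst.comp snd)) ?_
  refine option_map (primrec_tabLog.comp (fst.comp fst) (snd.comp (snd.comp fst))) ?_
  refine (list_getD []).comp (fst.comp (fst.comp (fst.comp fst))) ?_
  exact nat_mod.comp (nat_add.comp (snd.comp fst) snd) (snd.comp (fst.comp (fst.comp fst)))

theorem primrec_tabInv : Primrec₂ tabInv := by
  refine option_map (primrec_tabLog.comp fst snd) ?_
  refine (list_getD []).comp (fst.comp (fst.comp fst)) ?_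
  exact nat_mod.comp (nat_sub.comp (snd.comp (fst.comp fst)) snd) (snd.comp (fst.comp fst))

theorem primrec_tabCall :
    Primrec fun q : (List Str × ℕ) × Tape × Option Bool => tabCall q.1 q.2.1 q.2.2 := by
  have hs : Primrec fun t : Tape => readStr t.2 := primrec_readStr.comp snd
  have hd : Primrec fun t : Tape => readStr (t.2.drop ((readStr t.2).length + 1)) :=
    primrec_readStr.comp (list_drop.comp (succ.comp (list_length.comp hs)) snd)
  refine option_casesOn (snd.comp snd) (fst.comp snd) ?_
  have he : Primrec fun a : ((List Str × ℕ) × Tape × Option Bool) × Bool => a.1.1 := fst.comp fst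
  have ht : Primrec fun a : ((List Str × ℕ) × Tape × Option Bool) × Bool => a.1.2.1 :=
    fst.comp (snd.comp fst)
  refine Primrec.pair (const []) (primrec_cells.comp (option_getD.comp ?_ (const [])))
  exact cond snd (primrec_tabInv.comp he (hs.comp ht))
    (primrec_tabAdd.comp he (Primrec.pair (hs.comp ht) (hd.comp ht)))

theorem primrec_tabStep :
    Primrec fun q : (Machine × List Str × ℕ) × Config × Bool => tabStep q.1 q.2.1 q.2.2 := by
  have hc : Primrec fun q : (Machine × List Str × ℕ) × Config × Bool => q.2.1 := fst.comp snd
  have hq := fst.comp hc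
  have hw := fst.comp (snd.comp hc)
  have ho := snd.comp (snd.comp hc)
  refine ite (Primrec.eq.comp hq (const 1)) hc (option_getD.comp ?_
    (Primrec.pair (const 1) (Primrec.pair hw ho)))
  refine option_map (primrec_lookup.comp (Primrec.pair hq (Primrec.pair (primrec_read.comp hw)
    (Primrec.pair (primrec_read.comp ho) (snd.comp snd)))) (fst.comp fst)) ?_
  have r1 := snd (α := (Machine × List Str × ℕ) × Config × Bool)
    (β := ℕ × ℕ × ℕ × Option Bool × Option Bool × Option Bool)
  have r2 := snd.comp r1
  have r3 := snd.comp r2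
  have r4 := snd.comp r3
  have r5 := snd.comp r4
  refine Primrec.pair (fst.comp r1) (Primrec.pair ?_ ?_)
  · exact primrec_move.comp (primrec_write.comp (hw.comp fst) (fst.comp r2)) (fst.comp r4)
  · exact primrec_tabCall.comp (Primrec.pair (snd.comp (fst.comp fst)) (Primrec.pair
      (primrec_move.comp (primrec_write.comp (ho.comp fst) (fst.comp r3)) (fst.comp r5))
      (snd.comp r5)))

theorem primrec_binOfSize : Primrec₂ binOfSize := by
  refine list_map (list_reverse.comp (list_range.comp fst)) ?_
  have h : PrimrecPred fun q : (ℕ × ℕ) × ℕ => q.1.2 / 2 ^ q.2 % 2 = 1 :=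
    Primrec.eq.comp (nat_mod.comp (nat_div.comp (snd.comp fst) (primrec_pow.comp (const 2) snd))
      (const 2)) (const 1)
  exact h.decide

theorem primrec_tabInput :
    Primrec fun q : (ℕ × ℕ) × Str × Str => tabInput q.1.1 q.1.2 q.2.1 q.2.2 := by
  have hb : Primrec fun q : (ℕ × ℕ) × Str × Str => cells (binOfSize q.1.1 q.1.2) :=
    primrec_cells.comp (primrec_binOfSize.comp (fst.comp fst) (snd.comp fst))
  have h3 : ∀ {f : (ℕ × ℕ) × Str × Str → List ℕ}, Primrec f → Primrec fun q => 3 :: f q :=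
    fun hf => list_cons.comp (const 3) hf
  refine list_append.comp hb (h3 (list_append.comp hb (h3 (h3 (list_append.comp
    (primrec_cells.comp (fst.comp snd)) (h3 (list_append.comp (primrec_cells.comp (snd.comp snd))
      (const [3]))))))))

theorem primrec_tabOutput : Primrec fun q : (Machine × List Str) × (ℕ × ℕ × ℕ) × List Bool =>
    tabOutput q.1.1 q.1.2 q.2.1 q.2.2 := by
  have hl : Primrec fun q : (Machine × List Str) × (ℕ × ℕ × ℕ) × List Bool => q.1.2 :=
    snd.comp fst
  have ha : Primrec fun q : (Machine × List Str) × (ℕ × ℕ × ℕ) × List Bool => q.2.1 :=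
    fst.comp snd
  have h0 : Primrec fun q : (Machine × List Str) × (ℕ × ℕ × ℕ) × List Bool =>
      ((0, ([], tabInput q.2.1.1 q.2.1.2.1 (q.1.2.getD 1 []) (q.1.2.getD q.2.1.2.2 [])),
        ([], [])) : Config) :=
    Primrec.pair (const 0) (Primrec.pair (Primrec.pair (const [])
      (primrec_tabInput.comp (Primrec.pair (Primrec.pair (fst.comp ha) (fst.comp (snd.comp ha)))
        (Primrec.pair ((list_getD []).comp hl (const 1))
          ((list_getD []).comp hl (snd.comp (snd.comp ha))))))) (const ([], [])))
  have hs : Primrec₂ fun (q : (Machine × List Str) × (ℕ × ℕ × ℕ) × List Bool)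
      (r : Config × Bool) => tabStep (q.1.1, q.1.2, q.2.1.2.1) r.1 r.2 :=
    primrec_tabStep.comp (Primrec.pair (Primrec.pair (fst.comp (fst.comp fst))
      (Primrec.pair (hl.comp fst) (fst.comp (snd.comp (ha.comp fst))))) snd)
  have hf := list_foldl (snd.comp snd) h0 hs
  exact primrec_readStr.comp (snd.comp (fst.comp (snd.comp hf)))

theorem primrec_coinLists : Primrec coinLists := by
  have h : ∀ b, Primrec fun q : ℕ × List (List Bool) => q.2.map (List.cons b) := fun b =>
    list_map snd (list_cons.comp (const b) snd).to₂
  have h2 : Primrec₂ fun (_ : ℕ) (L : List (List Bool)) =>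
      L.map (List.cons false) ++ L.map (List.cons true) := list_append.comp (h false) (h true)
  exact nat_rec₁ _ h2

theorem primrec_machine : Primrec machine :=
  option_getD.comp (Primrec.decode.comp (fst.comp unpair)) (const [])

theorem primrec_steps : Primrec₂ steps :=
  nat_add.comp (primrec_pow.comp (nat_add.comp (nat_mul.comp (const 4) fst) (const 5)) snd) snd

theorem primrecPred_prime : PrimrecPred Nat.Prime := by
  have h : PrimrecRel fun m p : ℕ => ¬ p % m = 0 ∨ m = 1 :=
    (PrimrecPred.not (Primrec.eq.comp (nat_mod.comp snd fst) (const 0))).or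
      (Primrec.eq.comp fst (const 1))
  refine ((nat_le.comp (const 2) .id).and (h.forall_lt.comp .id .id)).of_eq fun p => ?_
  rw [Nat.prime_def_lt]
  simp only [id, Nat.dvd_iff_mod_eq_zero, imp_iff_not_or]

theorem primrecRel_bitPrime : PrimrecRel fun n p : ℕ => 2 ^ (n - 1) ≤ p ∧ p.Prime :=
  (nat_le.comp (primrec_pow.comp (const 2) (nat_sub.comp fst (const 1))) snd).and
    (primrecPred_prime.comp snd)

theorem primrec_tabSuccessCount : Primrec tabSuccessCount := by
  have hq : Primrec fun a : (((ℕ × ℕ × List Str) × ℕ) × ℕ) × List Bool => a.1.1.1 :=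
    fst.comp (fst.comp fst)
  have hm : Primrec fun a : (((ℕ × ℕ × List Str) × ℕ) × ℕ) × List Bool => machine a.1.1.1.2.1 :=
    primrec_machine.comp (fst.comp (snd.comp hq))
  have hl : Primrec fun a : (((ℕ × ℕ × List Str) × ℕ) × ℕ) × List Bool => a.1.1.1.2.2 :=
    snd.comp (snd.comp hq)
  have ha : Primrec fun a : (((ℕ × ℕ × List Str) × ℕ) × ℕ) × List Bool =>
      (a.1.1.1.1, a.1.1.2, a.1.2) :=
    Primrec.pair (fst.comp hq) (Primrec.pair (snd.comp (fst.comp fst)) (snd.comp fst))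
  have hi : Primrec fun a : (((ℕ × ℕ × List Str) × ℕ) × ℕ) × List Bool =>
      ((machine a.1.1.1.2.1, a.1.1.1.2.2), (a.1.1.1.1, a.1.1.2, a.1.2), a.2) :=
    Primrec.pair (Primrec.pair hm hl) (Primrec.pair ha snd)
  have ho := primrec_tabOutput.comp hi
  have hw : Primrec₂ fun (a : ((ℕ × ℕ × List Str) × ℕ) × ℕ) (r : List Bool) =>
      if strToNat (tabOutput (machine a.1.1.2.1) a.1.1.2.2 (a.1.1.1, a.1.2, a.2) r) = a.2
        then 1 else 0 :=
    ite (Primrec.eq.comp (primrec_strToNat.comp ho) (snd.comp fst)) (const 1) (const 0)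
  have hc : Primrec fun a : ((ℕ × ℕ × List Str) × ℕ) × ℕ => coinLists (steps a.1.1.1 a.1.1.2.1) :=
    primrec_coinLists.comp (primrec_steps.comp (fst.comp (fst.comp fst))
      (fst.comp (snd.comp (fst.comp fst))))
  have hx : Primrec₂ fun (a : (ℕ × ℕ × List Str) × ℕ) (x : ℕ) =>
      ((coinLists (steps a.1.1 a.1.2.1)).map fun r =>
        if strToNat (tabOutput (machine a.1.2.1) a.1.2.2 (a.1.1, a.2, x) r) = x
          then 1 else 0).sum := primrec_sum_map hc hw
  have hp : Primrec₂ fun (q : ℕ × ℕ × List Str) (p : ℕ) =>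
      if 2 ^ (q.1 - 1) ≤ p ∧ p.Prime then
        ((List.range p).map fun x => ((coinLists (steps q.1 q.2.1)).map fun r =>
          if strToNat (tabOutput (machine q.2.1) q.2.2 (q.1, p, x) r) = x then 1 else 0).sum).sum
      else 0 :=
    ite (primrecRel_bitPrime.comp (fst.comp fst) snd)
      (primrec_sum_map (list_range.comp snd) hx) (const 0)
  exact primrec_sum_map (list_range.comp (primrec_pow.comp (const 2) fst)) hp

theorem primrec_tabPrimeCount : Primrec tabPrimeCount :=
  primrec_sum_map (list_range.comp (primrec_pow.comp (const 2) .id))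
    (ite primrecRel_bitPrime (const 1) (const 0))

theorem primrec_level : Primrec level := by
  have h : PrimrecRel fun n k : ℕ => 2 ^ k ≤ n := nat_le.comp (primrec_pow.comp (const 2) snd) fst
  refine nat_sub.comp ((nat_findGreatest .id h).of_eq fun n => ?_) (const 20)
  rw [Nat.findGreatest_eq_iff]
  refine ⟨Nat.log_le_self 2 n, fun hk => Nat.pow_log_le_self 2 ?_, fun k hk _ hle => ?_⟩
  · rintro rfl
    simp at hk
  · have hn : n ≠ 0 := by
      rintro rfl
      have := Nat.one_le_two_pow (n := k)
      omega
    have := (Nat.le_log_iff_pow_le (by norm_num) hn).2 hle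
    omega

theorem primrecPred_forall_lt {f : α → ℕ} {R : ℕ → α → Prop} (hf : Primrec f)
    (hR : PrimrecRel R) : PrimrecPred fun a => ∀ k < f a, R k a :=
  (hR.forall_mem_list.comp (list_range.comp hf) .id).of_eq fun a => by simp

theorem primrecRel_goodTable : PrimrecRel GoodTable := by
  refine PrimrecPred.and (PrimrecPred.and ?_ (PrimrecPred.and ?_ ?_)) ?_
  · exact Primrec.eq.comp (list_length.comp snd) (primrec_pow.comp (const 2) fst)
  · have h : PrimrecRel fun (j : ℕ) (q : ℕ × List Str) => q.2.idxOf (q.2.getD j []) = j :=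
      Primrec.eq.comp (primrec_idxOf.comp ((list_getD []).comp (snd.comp snd) fst)
        (snd.comp snd)) fst
    exact primrecPred_forall_lt (list_length.comp snd) h
  · have h : PrimrecRel fun (s : Str) (n : ℕ) => s.length = n :=
      Primrec.eq.comp (list_length.comp fst) snd
    exact h.forall_mem_list.comp snd fst
  · have h : PrimrecRel fun (i : ℕ) (q : ℕ × List Str) =>
        q.1 ^ level q.1 * tabSuccessCount (q.1, i, q.2) ≤
          2 ^ (q.1 - 1) * 2 ^ steps q.1 i * tabPrimeCount q.1 := by
      have hn : Primrec fun a : ℕ × ℕ × List Str => a.2.1 := fst.comp snd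
      refine nat_le.comp (nat_mul.comp (primrec_pow.comp hn (primrec_level.comp hn))
        (primrec_tabSuccessCount.comp (Primrec.pair hn (Primrec.pair fst (snd.comp snd)))))
        (nat_mul.comp (nat_mul.comp ?_ ?_) (primrec_tabPrimeCount.comp hn))
      · exact primrec_pow.comp (const 2) (nat_sub.comp hn (const 1))
      · exact primrec_pow.comp (const 2) (primrec_steps.comp hn fst)
    exact primrecPred_forall_lt (primrec_level.comp fst) h

/-- Unbounded search makes computable choices. -/
theorem exists_computable_choice {R : α → β → Prop} (hR : PrimrecRel R) (h : ∀ a, ∃ b, R a b) :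
    ∃ f : α → β, Computable f ∧ ∀ a, R a (f a) := by
  classical
  let g : α → ℕ → Option β := fun a k =>
    (Encodable.decode k : Option β).bind fun b => if R a b then some b else none
  have hg : Primrec₂ g := by
    refine option_bind (Primrec.decode.comp snd) ?_
    exact ite (hR.comp (fst.comp fst) snd) (option_some.comp snd) (const none)
  have hp : Partrec fun a => Nat.rfindOpt (g a) := Partrec.rfindOpt hg.to_comp
  have hdom : ∀ a, (Nat.rfindOpt (g a)).Dom := fun a => by
    obtain ⟨b, hb⟩ := h a
    exact Nat.rfindOpt_dom.2 ⟨Encodable.encode b, b, by simp [g, hb]⟩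
  refine ⟨fun a => (Nat.rfindOpt (g a)).get (hdom a), hp.of_eq_tot fun a => Part.get_mem _,
    fun a => ?_⟩
  obtain ⟨k, hk⟩ := Nat.rfindOpt_spec (Part.get_mem (hdom a))
  simp only [g, Option.mem_def, Option.bind_eq_some_iff, Option.ite_none_right_eq_some] at hk
  obtain ⟨b, -, hb, e⟩ := hk
  have e : b = (Nat.rfindOpt (g a)).get (hdom a) := Option.some.inj e
  change R a ((Nat.rfindOpt (g a)).get (hdom a))
  rwa [← e]

end Computability

end GGM

theorem theorem8p4 :
    ∃ σ : GGM.Family, σ.IsComputable ∧ GGM.EffectivelyHard σ ∧ GGM.Hard σ := by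
  open GGM in
  obtain ⟨l, hl, hgood⟩ := exists_computable_choice primrecRel_goodTable exists_goodTable
  choose σ hσ using fun n => (hgood n).exists_encf
  have heff : EffectivelyHard σ := by
    refine ⟨fun i d => 2 ^ (i + d + 21), ?_, fun i d n _ _ hn hf => ?_⟩
    · exact (primrec_pow.comp (.const 2) (Primrec.nat_add.comp (Primrec.nat_add.comp .fst .snd)
        (.const 21))).to_comp.to₂
    · have hlog : i + d + 21 ≤ Nat.log 2 n :=
        (Nat.le_log_iff_pow_le (by norm_num) (by omega)).2 hf
      have hlevel : i + d + 1 ≤ level n := by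
        unfold level
        omega
      have h := (hgood n).2 i (by omega)
      rw [← hσ n, tabSuccessCount_table hn, tabPrimeCount_eq] at h
      have hn1 : (1 : ℚ) ≤ n := by exact_mod_cast hn
      calc dlogProbEnum i (σ n) ≤ 1 / (n : ℚ) ^ level n := dlogProbEnum_le_of_successCount hn h
        _ ≤ 1 / (n : ℚ) ^ d :=
          one_div_le_one_div_of_le (by positivity) (pow_le_pow_right₀ hn1 (by omega))
  refine ⟨σ, ⟨fun n x => (l n).getD x [], ?_, fun n x => ?_⟩, heff, heff.hard⟩
  · exact (Primrec.list_getD []).to_comp.comp (hl.comp .fst) .snd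
  · dsimp only
    rw [← hσ n, Encf.getD_table, Encf.str_of_lt _ x.2]
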